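/- Let $A$ be an associative unital ring, let $\mathcal{D}(A)$ be the derived category of left $A$-modules, and view modules as complexes concentrated in degree $0$. Let $n\ge 0$, and let $T$ be a (not necessarily classical) $n$-tilting left $A$-module. This means that: (P) there is an exact sequence $0\to P_n\to\cdots\to P_0\to T\to 0$ with all $P_j$ projective; (E) $\mathrm{Ext}_A^j(T,T^{(\Lambda)})=0$ for all $0<j\le n$ and all sets $\Lambda$; (G) if $X\in\mathcal{D}(A)$ satisfies $\mathrm{Hom}_{\mathcal{D}(A)}(T,X[j])=0$ for all $j\in\mathbb{Z}$, then $X=0$. For $m\in\mathbb{Z}$ put $\mathcal{D}^{\ge m}=\{X\in\mathcal{D}(A): H^j(X)=0 \text{ for all } j<m\}$, and put $\mathcal{T}^{\ge 0}=\{X\in\mathcal{D}(A): \mathrm{Hom}_{\mathcal{D}(A)}(T,X[j])=0 \text{ for all } j<0\}$. For $i=0,\dots,n$ let $$\mathcal{D}_i^{\ge}=\mathcal{D}^{\ge -i}\cap\mathcal{T}^{\ge 0}.$$ Then: 1. For every $i=0,\dots,n$, $\mathcal{D}_i^{\ge}$ is the coaisle $\mathcal{S}^{\ge 0}$ of a $t$-structure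 $(\mathcal{S}^{\le 0},\mathcal{S}^{\ge 0})$ on $\mathcal{D}(A)$, namely of the one generated by $T\oplus A[i]$: its aisle $\mathcal{S}^{\le 0}$ is the smallest strict full subcategory of $\mathcal{D}(A)$ that contains $T\oplus A[i]$ and is closed under positive shifts, extensions and arbitrary set-indexed coproducts. 2. $\mathcal{D}^{\ge 0}=\mathcal{D}_0^{\ge}\subseteq\mathcal{D}_1^{\ge}\subseteq\cdots\subseteq\mathcal{D}_n^{\ge}=\mathcal{T}^{\ge 0}$. 3. $\mathcal{D}_{i-1}^{\ge}\subseteq\mathcal{D}_i^{\ge}\subseteq\mathcal{D}_{i-1}^{\ge}[1]$ for $i=1,\dots,n$. -/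

import Mathlib

open CategoryTheory CategoryTheory.Limits CategoryTheory.Pretriangulated
  CategoryTheory.Triangulated

universe w u

namespace TiltingTStructure

section Generated

variable {C : Type*} [Category* C] [Preadditive C] [HasZeroObject C] [HasShift C ℤ]
  [∀ n : ℤ, (shiftFunctor C n).Additive] [Pretriangulated C]

/-- A strict full subcategory `P` of a triangulated category is a *cocomplete pre-aisle* if it is
closed under positive shifts, extensions and coproducts indexed by sets (i.e. types in `Type u`). -/
structure IsCocompletePreaisle (P : ObjectProperty C) : Prop where
  of_iso {X Y : C} (e : X ≅ Y) (hX : P X) : P Y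
  shift (X : C) (hX : P X) (i : ℤ) (hi : 0 < i) : P (X⟦i⟧)
  extension (D : Triangle C) (hD : D ∈ distTriang C) (h₁ : P D.obj₁) (h₃ : P D.obj₃) : P D.obj₂
  coproduct (J : Type u) (F : J → C) (c : Cofan F) (hc : Nonempty (IsColimit c))
    (hF : ∀ j, P (F j)) : P c.pt

/-- The smallest cocomplete pre-aisle containing the object `E`. -/
def generatedPreaisle (E : C) : ObjectProperty C := fun X =>
  ∀ P : ObjectProperty C, IsCocompletePreaisle.{u} P → P E → P X

/-- `t` is the t-structure generated by the object `E`: its aisle is the smallest cocomplete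
pre-aisle containing `E`. -/
def IsGeneratedBy (t : TStructure C) (E : C) : Prop :=
  t.le 0 = generatedPreaisle.{u} E

/-- `P[1]`, the strict full subcategory of the objects isomorphic to `X[1]` for some `X` in `P`. -/
def suspension (P : ObjectProperty C) : ObjectProperty C := fun Y =>
  ∃ X : C, P X ∧ Nonempty (Y ≅ X⟦(1 : ℤ)⟧)

end Generated

section Tilting

variable {A : Type u} [Ring A] [HasDerivedCategory.{w} (ModuleCat.{u} A)]

/-- A module, regarded as a complex concentrated in degree `0`. -/
noncomputable abbrev inDegreeZero (M : ModuleCat.{u} A) : DerivedCategory (ModuleCat.{u} A) :=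
  (DerivedCategory.singleFunctor (ModuleCat.{u} A) 0).obj M

/-- (Not necessarily classical) `n`-tilting left `A`-modules. -/
structure IsTilting (n : ℕ) (T : ModuleCat.{u} A) : Prop where
  /-- There is an exact sequence `0 ⟶ Pₙ ⟶ ⋯ ⟶ P₀ ⟶ T ⟶ 0` with all `Pᵢ` projective. -/
  projective_dimension :
    ∃ P : ProjectiveResolution T, ∀ i : ℕ, n < i → IsZero (P.complex.X i)
  /-- `Extⁱ(T, T^(Λ)) = 0` for `0 < i ≤ n` and every set `Λ`. -/
  rigid (i : ℕ) (hi : 0 < i) (hin : i ≤ n) (Λ : Type u) :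
    Subsingleton (Abelian.Ext.{u} T (ModuleCat.of A (Λ →₀ T)) i)
  /-- `T` is a generator of `D(A)`. -/
  generator (X : DerivedCategory (ModuleCat.{u} A))
    (hX : ∀ (i : ℤ) (f : inDegreeZero T ⟶ X⟦i⟧), f = 0) : IsZero X

/-- `𝒯^{≥0}`: the complexes `X` with `Hom(T, X[i]) = 0` for all `i < 0`. -/
def tiltingGE (T : ModuleCat.{u} A) : ObjectProperty (DerivedCategory (ModuleCat.{u} A)) :=
  fun X => ∀ i : ℤ, i < 0 → ∀ f : inDegreeZero T ⟶ X⟦i⟧, f = 0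

/-- `𝒟^{≥m}` for the natural t-structure `𝒟` of `D(A)`: the complexes `X` such that
`Hʲ(X) = 0` for all `j < m`. -/
def naturalGE (A : Type u) [Ring A] [HasDerivedCategory.{w} (ModuleCat.{u} A)] (m : ℤ) :
    ObjectProperty (DerivedCategory (ModuleCat.{u} A)) :=
  fun X => ∀ j : ℤ, j < m →
    IsZero ((DerivedCategory.homologyFunctor (ModuleCat.{u} A) j).obj X)

/-- `𝒟ᵢ^≥ = 𝒟^{≥-i} ∩ 𝒯^{≥0}`. -/
def intermediateGE (T : ModuleCat.{u} A) (i : ℕ) :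
    ObjectProperty (DerivedCategory (ModuleCat.{u} A)) :=
  naturalGE A (-(i : ℤ)) ⊓ tiltingGE T

end Tilting

end TiltingTStructure

/-!
The intersection `𝒟^{≥-i} ∩ 𝒯^{≥0}` is the right orthogonal of the positive shifts of `T ⊞ A[i]`,
because morphisms from the shifts of `A` detect cohomology (`intermediateGE_iff`). Two facts
remain: such an orthogonal is the coaisle of the t-structure generated by the object, and `𝒯^{≥0}`
is contained in `𝒟^{≥-n}`. The remaining inclusions are formal.

*Generated t-structures.* Let `S` be the cocomplete pre-aisle generated by an object which is
represented by a K-projective complex `G`. Truncation triangles come from the small object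
argument (`exists_monoWithCokernel_extension`, `IsCocompletePreaisle.exists_triangle`): attach the
cones of the complexes `G⟦k⟧`, `k ≥ 0`, to a complex `X` transfinitely often, until every morphism
of complexes `G⟦k⟧ ⟶ V` extends to the contractible cone of `G⟦k⟧`. As `G` is K-projective, `V` is
then orthogonal to these shifts in `D(A)`. That the fibre of `X ⟶ V` lies in `S` requires that
monomorphisms of complexes with cokernel in (a shift of) `S` be closed under transfinite
composition, hence that `S` be closed under the colimits of well-ordered diagrams of complexes
(`IsCocompletePreaisle.Q_colimit`). Pre-aisles are only assumed to be closed under coproducts. A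
colimit over a linear order is the target of a map from a coproduct which is surjective on
homology, and the kernel of this map is a colimit of the same kind. Iterating, one resolves the
colimit by coproducts, and splicing the resulting triangles writes it as a homotopy colimit of a
sequence in `S` (`IsCocompletePreaisle.of_homologyExact_resolution`, `exists_homotopyColimit`).
The outcome is `exists_tStructure_of_isKProjective`.

*The tilting module.* Let `Y` admit no nonzero morphism from `T⟦m⟧` for `m ≥ 0`. Morphisms `A⟦n⟧ ⟶
Y` vanish (`IsTilting.eq_zero_of_shift_nonneg`): because `T` has projective dimension at most `n`,
there are no nonzero morphisms from `T⟦m⟧` to `A⟦n⟧` for `m < 0`. Coning off coproducts of copies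
of `T`, `T⟦1⟧`, `T⟦2⟧`, … gives a tower in which the `k`-th stage admits no nonzero morphism from
`T⟦m⟧` for `m < k`; no new ones appear, as `T` has no self-extensions (`IsTilting.exists_next`).
The tower becomes stationary in each cohomological degree, so its homotopy colimit is orthogonal
to all shifts of `T`, and it is zero because `T` is a generator. On the other hand, `A⟦n⟧ ⟶ Y`
extends along the tower to the homotopy colimit.
-/

namespace TiltingTStructure

/-! ### Coproducts in derived categories -/

section

section Exactness

variable {C : Type*} [Category* C] [Preadditive C] [HasZeroObject C] [HasShift C ℤ]
  [∀ n : ℤ, (shiftFunctor C n).Additive] [Pretriangulated C]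
  {X Y Z W : C} {f : X ⟶ Y} {g : Y ⟶ Z} {h : Z ⟶ X⟦(1 : ℤ)⟧}

theorem comp_eq_zero₁₂ (hT : Triangle.mk f g h ∈ distTriang C) : f ≫ g = 0 :=
  comp_distTriang_mor_zero₁₂ _ hT

theorem comp_eq_zero₂₃ (hT : Triangle.mk f g h ∈ distTriang C) : g ≫ h = 0 :=
  comp_distTriang_mor_zero₂₃ _ hT

theorem exists_lift₂ (hT : Triangle.mk f g h ∈ distTriang C) (a : W ⟶ Y) (ha : a ≫ g = 0) :
    ∃ b : W ⟶ X, b ≫ f = a := by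
  obtain ⟨b, hb⟩ := Triangle.coyoneda_exact₂ _ hT a ha
  exact ⟨b, hb.symm⟩

theorem exists_lift₃ (hT : Triangle.mk f g h ∈ distTriang C) (a : W ⟶ Z) (ha : a ≫ h = 0) :
    ∃ b : W ⟶ Y, b ≫ g = a := by
  obtain ⟨b, hb⟩ := Triangle.coyoneda_exact₃ _ hT a ha
  exact ⟨b, hb.symm⟩

theorem exists_desc₂ (hT : Triangle.mk f g h ∈ distTriang C) (a : Y ⟶ W) (ha : f ≫ a = 0) :
    ∃ b : Z ⟶ W, g ≫ b = a := by
  obtain ⟨b, hb⟩ := Triangle.yoneda_exact₂ _ hT a ha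
  exact ⟨b, hb.symm⟩

theorem distinguished_of_iso {X' Y' Z' : C} {f' : X' ⟶ Y'} {g' : Y' ⟶ Z'} {h' : Z' ⟶ X'⟦(1 : ℤ)⟧}
    (hT : Triangle.mk f g h ∈ distTriang C) (e₁ : X' ≅ X) (e₂ : Y' ≅ Y) (e₃ : Z' ≅ Z)
    (h₁ : f' ≫ e₂.hom = e₁.hom ≫ f) (h₂ : g' ≫ e₃.hom = e₂.hom ≫ g)
    (h₃ : h' ≫ e₁.hom⟦(1 : ℤ)⟧' = e₃.hom ≫ h) : Triangle.mk f' g' h' ∈ distTriang C :=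
  isomorphic_distinguished _ hT _ (Triangle.isoMk _ _ e₁ e₂ e₃ h₁ h₂ h₃)

theorem distinguished_of_iso₂ {Y' : C} (hT : Triangle.mk f g h ∈ distTriang C) (e : Y' ≅ Y) :
    Triangle.mk (f ≫ e.inv) (e.hom ≫ g) h ∈ distTriang C :=
  distinguished_of_iso hT (Iso.refl _) e (Iso.refl _) (by simp) (by simp) (by simp)

theorem distinguished_of_iso₃ {Z' : C} (hT : Triangle.mk f g h ∈ distTriang C) (e : Z' ≅ Z) :
    Triangle.mk f (g ≫ e.inv) (e.hom ≫ h) ∈ distTriang C :=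
  distinguished_of_iso hT (Iso.refl _) (Iso.refl _) e (by simp) (by simp) (by simp)

end Exactness

section HomologyColimits

universe v₁ u₁ v₂ u₂

variable {J : Type u₁} [Category.{v₁} J] {C : Type u₂} [Category.{v₂} C] [Abelian C]
  [HasColimitsOfShape J C]

/-- The natural transformation from evaluation at `j` to the colimit functor. -/
noncomputable def evaluationToColim (j : J) : (evaluation J C).obj j ⟶ colim where
  app F := colimit.ι F j
  naturality _ _ f := by simp

theorem preservesColimitsOfShape_shortComplex_homologyFunctor [HasExactColimitsOfShape J C] :
    PreservesColimitsOfShape J (ShortComplex.homologyFunctor C) where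
  preservesColimit {F} := by
    let S : ShortComplex (J ⥤ C) := (ShortComplex.FunctorEquivalence.inverse J C).obj F
    -- the colimit of `F` is computed degreewise, and `colim` commutes with homology
    let c : Cocone F :=
      { pt := S.map colim
        ι :=
          { app j := S.mapNatTrans (evaluationToColim j)
            naturality j j' f := by
              ext
              · exact (colimit.w (F ⋙ ShortComplex.π₁) f).trans (Category.comp_id _).symm
              · exact (colimit.w (F ⋙ ShortComplex.π₂) f).trans (Category.comp_id _).symm
              · exact (colimit.w (F ⋙ ShortComplex.π₃) f).trans (Category.comp_id _).symm } }
    have hc : IsColimit c := ShortComplex.isColimitOfIsColimitπ c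
      (colimit.isColimit (F ⋙ ShortComplex.π₁)) (colimit.isColimit (F ⋙ ShortComplex.π₂))
      (colimit.isColimit (F ⋙ ShortComplex.π₃))
    let α : S.homology ≅ F ⋙ ShortComplex.homologyFunctor C :=
      NatIso.ofComponents (fun j ↦ (S.mapHomologyIso ((evaluation J C).obj j)).symm)
        (fun {j j'} f ↦ by
          have := NatTrans.app_homology ((evaluation J C).map f) S
          refine (this =≫ _).trans ((Category.assoc _ _ _).trans (congr_arg _ ?_))
          exact (Category.assoc _ _ _).trans
            ((congr_arg _ (Iso.hom_inv_id _)).trans (Category.comp_id _)))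
    refine preservesColimit_of_preserves_colimit_cocone hc
      (IsColimit.equivOfNatIsoOfIso α (colimit.cocone S.homology)
        ((ShortComplex.homologyFunctor C).mapCocone c)
        (Cocone.ext (S.mapHomologyIso colim).symm ?_) (colimit.isColimit _))
    intro j
    have := NatTrans.app_homology (evaluationToColim (C := C) j) S
    exact (Iso.comp_inv_eq _).2 ((Iso.eq_inv_comp _).1 this)

theorem preservesColimitsOfShape_homologyFunctor [HasExactColimitsOfShape J C]
    {ι : Type*} (c : ComplexShape ι) (i : ι) :
    PreservesColimitsOfShape J (HomologicalComplex.homologyFunctor C c i) := by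
  have : PreservesColimitsOfShape J (HomologicalComplex.shortComplexFunctor C c i) :=
    { preservesColimit := fun {F} ↦
        { preserves := fun {d} hd ↦ ⟨ShortComplex.isColimitOfIsColimitπ _
            (isColimitOfPreserves (HomologicalComplex.eval C c _) hd)
            (isColimitOfPreserves (HomologicalComplex.eval C c _) hd)
            (isColimitOfPreserves (HomologicalComplex.eval C c _) hd)⟩ } }
  have := preservesColimitsOfShape_shortComplex_homologyFunctor (J := J) (C := C)
  exact preservesColimitsOfShape_of_natIso
    (HomologicalComplex.homologyFunctorIso C c i).symm

end HomologyColimits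

section Coproducts

variable {C : Type*} [Category* C] [Abelian C]

/-- Exact colimits of quasi-isomorphisms are quasi-isomorphisms. -/
theorem quasiIso_of_isColimit {J : Type*} [Category* J] [HasColimitsOfShape J C]
    [HasExactColimitsOfShape J C] {F G : J ⥤ CochainComplex C ℤ} {c : Cocone F} {d : Cocone G}
    (hc : IsColimit c) (hd : IsColimit d) (σ : F ⟶ G) [∀ j, QuasiIso (σ.app j)]
    (φ : c.pt ⟶ d.pt) (hφ : ∀ j, c.ι.app j ≫ φ = σ.app j ≫ d.ι.app j) : QuasiIso φ := by
  rw [quasiIso_iff]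
  intro i
  rw [quasiIsoAt_iff_isIso_homologyMap]
  have := preservesColimitsOfShape_homologyFunctor (J := J) (C := C) (ComplexShape.up ℤ) i
  let H := HomologicalComplex.homologyFunctor C (ComplexShape.up ℤ) i
  have : ∀ j, IsIso ((Functor.whiskerRight σ H).app j) := fun j ↦ by
    have := (quasiIso_iff (σ.app j)).1 inferInstance i
    rw [quasiIsoAt_iff_isIso_homologyMap] at this
    exact this
  have : IsIso (Functor.whiskerRight σ H) := NatIso.isIso_of_isIso_app _
  let e := (isColimitOfPreserves H hc).coconePointsIsoOfNatIso (isColimitOfPreserves H hd)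
    (asIso (Functor.whiskerRight σ H))
  have he : e.hom = H.map φ := (isColimitOfPreserves H hc).hom_ext fun j ↦ by
    refine ((isColimitOfPreserves H hc).comp_coconePointsIsoOfNatIso_hom _ _ j).trans ?_
    exact (H.map_comp _ _).symm.trans ((congr_arg H.map (hφ j)).symm.trans (H.map_comp _ _))
  change IsIso (H.map φ)
  rw [← he]
  infer_instance

variable [HasDerivedCategory.{w} C]

/-- The existence half of the universal property of a coproduct in the derived category: each
morphism is a fraction with a quasi-isomorphism as denominator, and a coproduct of these
denominators is again a quasi-isomorphism. -/
theorem Q_coproduct_exists_desc {J : Type*} [HasCoproductsOfShape J C]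
    [HasExactColimitsOfShape (Discrete J) C] {F : Discrete J ⥤ CochainComplex C ℤ} {c : Cocone F}
    (hc : IsColimit c) {Y : DerivedCategory C}
    (f : ∀ j, DerivedCategory.Q.obj (F.obj j) ⟶ Y) :
    ∃ g : DerivedCategory.Q.obj c.pt ⟶ Y, ∀ j, DerivedCategory.Q.map (c.ι.app j) ≫ g = f j := by
  obtain ⟨L, ⟨e⟩⟩ : ∃ L, Nonempty (DerivedCategory.Q.obj L ≅ Y) :=
    ⟨_, ⟨DerivedCategory.Q.objObjPreimageIso Y⟩⟩
  choose X s hs a ha using fun j : Discrete J ↦ DerivedCategory.right_fac (f j ≫ e.inv)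
  let G : Discrete J ⥤ CochainComplex C ℤ := Discrete.functor (fun j ↦ X ⟨j⟩)
  let σ : G ⟶ F := Discrete.natTrans (fun j ↦ s j)
  let φ : colimit G ⟶ c.pt := colimMap σ ≫ (hc.coconePointUniqueUpToIso (colimit.isColimit F)).inv
  have hφ (j) : colimit.ι G j ≫ φ = σ.app j ≫ c.ι.app j := by simp [φ]
  have hσ (j : Discrete J) : QuasiIso (σ.app j) := by
    have := hs j
    rw [DerivedCategory.isIso_Q_map_iff_quasiIso] at this
    exact this
  have : QuasiIso φ := quasiIso_of_isColimit (colimit.isColimit G) hc σ φ hφ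
  let b : colimit G ⟶ L := colimit.desc G (Cocone.mk L (Discrete.natTrans (fun j ↦ a j)))
  refine ⟨inv (DerivedCategory.Q.map φ) ≫ DerivedCategory.Q.map b ≫ e.hom, fun j ↦ ?_⟩
  have h₁ : DerivedCategory.Q.map (c.ι.app j) ≫ inv (DerivedCategory.Q.map φ) =
      inv (DerivedCategory.Q.map (s j)) ≫ DerivedCategory.Q.map (colimit.ι G j) := by
    have := hs j
    rw [IsIso.eq_inv_comp, ← Category.assoc, IsIso.comp_inv_eq, ← Functor.map_comp,
      ← Functor.map_comp, hφ]
    rfl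
  have h₂ : colimit.ι G j ≫ b = a j := by simp [b]
  rw [reassoc_of% h₁, ← Functor.map_comp_assoc, h₂, ← Category.assoc, ← ha]
  simp

/-- The localization functor to the derived category preserves exact coproducts. -/
theorem preservesColimitsOfShape_Q (J : Type*) [HasCoproductsOfShape J C]
    [HasExactColimitsOfShape (Discrete J) C] :
    PreservesColimitsOfShape (Discrete J)
      (DerivedCategory.Q : CochainComplex C ℤ ⥤ DerivedCategory C) where
  preservesColimit {F} :=
    { preserves := fun {c} hc ↦ by
        -- a morphism vanishing on the summands lifts the identity through its fibre
        have inj {Y : DerivedCategory C} (f : DerivedCategory.Q.obj c.pt ⟶ Y)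
            (hf : ∀ j, DerivedCategory.Q.map (c.ι.app j) ≫ f = 0) : f = 0 := by
          obtain ⟨Z, p, q, hT⟩ := Pretriangulated.distinguished_cocone_triangle₁ f
          choose a ha using fun j ↦ exists_lift₂ hT _ (hf j)
          obtain ⟨g, hg⟩ := Q_coproduct_exists_desc hc a
          have hi : IsIso (g ≫ p) := by
            rw [DerivedCategory.isIso_iff]
            intro i
            have := preservesColimitsOfShape_homologyFunctor
              (J := Discrete J) (C := C) (ComplexShape.up ℤ) i
            have := preservesColimitsOfShape_of_natIso (J := Discrete J)
              (DerivedCategory.homologyFunctorFactors C i).symm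
            have h := isColimitOfPreserves (DerivedCategory.Q ⋙ DerivedCategory.homologyFunctor C i)
              hc
            have h' : (DerivedCategory.homologyFunctor C i).map (g ≫ p) = 𝟙 _ :=
              h.hom_ext fun j ↦ by
                dsimp
                rw [← Functor.map_comp, reassoc_of% hg, Category.comp_id]
                exact congr_arg _ (ha j)
            rw [h']
            infer_instance
          have h0 : (g ≫ p) ≫ f = 0 := by
            rw [Category.assoc, comp_eq_zero₁₂ hT, comp_zero]
          rwa [← cancel_epi (g ≫ p), comp_zero]
        refine ⟨{ desc s := (Q_coproduct_exists_desc hc (fun j ↦ s.ι.app j)).choose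
                  fac s j := (Q_coproduct_exists_desc hc (fun j ↦ s.ι.app j)).choose_spec j
                  uniq s m hm := ?_ }⟩
        rw [← sub_eq_zero]
        refine inj _ fun j ↦ ?_
        rw [Preadditive.comp_sub, sub_eq_zero]
        exact (hm j).trans
          ((Q_coproduct_exists_desc hc (fun j ↦ s.ι.app j)).choose_spec j).symm }

end Coproducts

end

/-! ### Homotopy colimits of sequences in `D(A)` -/

section

section DerivedCoproducts

variable {C : Type*} [Category* C] [Abelian C] [HasDerivedCategory.{w} C]
  (J : Type*) [HasCoproductsOfShape J C] [HasExactColimitsOfShape (Discrete J) C]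

theorem hasCoproductsOfShape_derivedCategory : HasCoproductsOfShape J (DerivedCategory C) where
  has_colimit F := by
    have := preservesColimitsOfShape_Q (C := C) J
    let G : Discrete J ⥤ CochainComplex C ℤ :=
      Discrete.functor (fun j ↦ DerivedCategory.Q.objPreimage (F.obj ⟨j⟩))
    let e : G ⋙ DerivedCategory.Q ≅ F :=
      Discrete.natIso (fun j ↦ DerivedCategory.Q.objObjPreimageIso (F.obj j))
    exact hasColimit_of_iso e.symm

theorem preservesCoproductsOfShape_derivedCategory_homologyFunctor (i : ℤ) :
    PreservesColimitsOfShape (Discrete J) (DerivedCategory.homologyFunctor C i) where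
  preservesColimit {F} := by
    have := preservesColimitsOfShape_Q (C := C) J
    have := preservesColimitsOfShape_homologyFunctor
      (J := Discrete J) (C := C) (ComplexShape.up ℤ) i
    have := preservesColimitsOfShape_of_natIso (J := Discrete J)
      (DerivedCategory.homologyFunctorFactors C i).symm
    let G : Discrete J ⥤ CochainComplex C ℤ :=
      Discrete.functor (fun j ↦ DerivedCategory.Q.objPreimage (F.obj ⟨j⟩))
    let e : G ⋙ DerivedCategory.Q ≅ F :=
      Discrete.natIso (fun j ↦ DerivedCategory.Q.objObjPreimageIso (F.obj j))
    have : PreservesColimit (G ⋙ DerivedCategory.Q) (DerivedCategory.homologyFunctor C i) :=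
      preservesColimit_of_preserves_colimit_cocone
        (isColimitOfPreserves DerivedCategory.Q (colimit.isColimit G))
        (isColimitOfPreserves (DerivedCategory.Q ⋙ DerivedCategory.homologyFunctor C i)
          (colimit.isColimit G))
    exact preservesColimit_of_iso_diagram _ e

end DerivedCoproducts

variable {A : Type u} [Ring A]

open scoped DirectSum in
/-- In a category of modules, an element of a coproduct is determined by its components. -/
theorem eq_zero_of_components_eq_zero {J : Type} {M : J → ModuleCat.{u} A} {c : Cofan M}
    (hc : IsColimit c) (π : ∀ j, c.pt ⟶ M j) (h₁ : ∀ j, c.inj j ≫ π j = 𝟙 _)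
    (h₂ : ∀ j k, j ≠ k → c.inj j ≫ π k = 0) (x : c.pt) (hx : ∀ j, π j x = 0) : x = 0 := by
  classical
  let e := hc.coconePointUniqueUpToIso (ModuleCat.coproductCoconeIsColimit M)
  have he (j : J) : e.inv ≫ π j = ModuleCat.ofHom (DirectSum.component A J (fun j ↦ M j) j) := by
    refine Cofan.IsColimit.hom_ext (ModuleCat.coproductCoconeIsColimit M) _ _ fun k ↦ ?_
    have : (ModuleCat.coproductCocone M).inj k ≫ e.inv = c.inj k :=
      hc.comp_coconePointUniqueUpToIso_inv (ModuleCat.coproductCoconeIsColimit M) ⟨k⟩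
    rw [reassoc_of% this]
    ext y
    change _ = (DirectSum.lof A J (fun j ↦ M j) k y) j
    by_cases hjk : k = j
    · subst hjk
      rw [h₁, DirectSum.lof_apply]
      rfl
    · rw [h₂ _ _ hjk, DirectSum.lof_eq_of, DirectSum.of_eq_of_ne _ _ _ (Ne.symm hjk)]
      rfl
  have h0 : e.hom x = 0 := by
    refine DFinsupp.ext fun j ↦ ?_
    have := congr_arg (fun f ↦ f (e.hom x)) (he j)
    have h' : e.inv (e.hom x) = x := by simp
    dsimp at this
    rw [h', hx] at this
    exact this.symm
  have : e.inv (e.hom x) = 0 := by rw [h0, map_zero]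
  simpa using this

theorem IsCocompletePreaisle.coproduct_nat {C : Type*} [Category* C] [Preadditive C]
    [HasZeroObject C] [HasShift C ℤ] [∀ n : ℤ, (shiftFunctor C n).Additive] [Pretriangulated C]
    {S : ObjectProperty C} (hS : IsCocompletePreaisle.{u} S) {F : ℕ → C} {c : Cofan F}
    (hc : IsColimit c) (hF : ∀ j, S (F j)) : S c.pt := by
  let c' : Cofan (fun j : ULift.{u} ℕ ↦ F j.down) := Cofan.mk c.pt (fun j ↦ c.inj j.down)
  have hc' : IsColimit c' :=
    Cofan.IsColimit.mk _ (fun s ↦ Cofan.IsColimit.desc hc (fun j ↦ s.inj ⟨j⟩)) (by simp [c'])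
      (fun s m hm ↦ Cofan.IsColimit.hom_ext hc _ _ fun j ↦ by simpa [c'] using hm ⟨j⟩)
  exact hS.coproduct _ _ c' ⟨hc'⟩ (fun j ↦ hF j.down)

variable [HasDerivedCategory.{w} (ModuleCat.{u} A)]

/-- Every sequence in `D(A)` has a homotopy colimit: a weakly initial cocone which becomes a colimit
cocone after taking homology, and whose point lies in every cocomplete pre-aisle that contains the
sequence. -/
theorem exists_homotopyColimit (F : ℕ ⥤ DerivedCategory (ModuleCat.{u} A)) :
    ∃ c : Cocone F, (∀ c' : Cocone F, ∃ g : c.pt ⟶ c'.pt, ∀ k, c.ι.app k ≫ g = c'.ι.app k) ∧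
      (∀ i, Nonempty (IsColimit
        ((DerivedCategory.homologyFunctor (ModuleCat.{u} A) i).mapCocone c))) ∧
      ∀ S : ObjectProperty (DerivedCategory (ModuleCat.{u} A)), IsCocompletePreaisle.{u} S →
        (∀ k, S (F.obj k)) → S c.pt := by
  have := hasCoproductsOfShape_derivedCategory (C := ModuleCat.{u} A) ℕ
  -- the cone of `1 - shift`
  let φ : ∐ F.obj ⟶ ∐ F.obj :=
    Sigma.desc (fun k ↦ Sigma.ι F.obj k - F.map (homOfLE k.le_succ) ≫ Sigma.ι F.obj (k + 1))
  have hφ (k : ℕ) : Sigma.ι F.obj k ≫ φ =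
      Sigma.ι F.obj k - F.map (homOfLE k.le_succ) ≫ Sigma.ι F.obj (k + 1) := by simp [φ]
  obtain ⟨L, p, δ, hT⟩ := Pretriangulated.distinguished_cocone_triangle φ
  have hφp := comp_eq_zero₁₂ hT
  let c : Cocone F :=
    { pt := L
      ι := NatTrans.ofSequence (fun k ↦ Sigma.ι F.obj k ≫ p) (fun k ↦ by
        have := Sigma.ι F.obj k ≫= hφp
        rw [reassoc_of% hφ, Preadditive.sub_comp, comp_zero, sub_eq_zero] at this
        simpa using this.symm) }
  have hc (k : ℕ) : c.ι.app k = Sigma.ι F.obj k ≫ p := rfl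
  refine ⟨c, fun c' ↦ ?_, fun i ↦ ?_, fun S hS hF ↦ ?_⟩
  · obtain ⟨g, hg⟩ := exists_desc₂ hT (Sigma.desc (fun k ↦ c'.ι.app k)) (by
      refine Sigma.hom_ext _ _ fun k ↦ ?_
      rw [reassoc_of% hφ, Preadditive.sub_comp]
      simp)
    exact ⟨g, fun k ↦ by simp [hc, hg]⟩
  · let H := DerivedCategory.homologyFunctor (ModuleCat.{u} A)
    have hpres (i : ℤ) : PreservesColimitsOfShape (Discrete ℕ) (H i) :=
      preservesCoproductsOfShape_derivedCategory_homologyFunctor ℕ i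
    -- pushing the components in degrees `≤ n` of `φ x` forward to `F n` and adding them up gives a
    -- telescoping sum, equal to the `n`-th component of `x`
    have hmono (i : ℤ) : Mono ((H i).map φ) := by
      let σ (n : ℕ) : ∐ F.obj ⟶ F.obj n :=
        Sigma.desc (fun k ↦ if h : k ≤ n then F.map (homOfLE h) else 0)
      have hσ₁ (n : ℕ) : Sigma.ι F.obj n ≫ φ ≫ σ n = 𝟙 _ := by
        rw [reassoc_of% hφ, Preadditive.sub_comp]
        simp [σ]
      have hσ₂ (k n : ℕ) (hkn : k ≠ n) : Sigma.ι F.obj k ≫ φ ≫ σ n = 0 := by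
        rw [reassoc_of% hφ, Preadditive.sub_comp]
        by_cases h : k < n
        · have h' : k + 1 ≤ n := h
          simp [σ, h.le, h', ← Functor.map_comp]
        · have h' : ¬ (k ≤ n) := by lia
          have h'' : ¬ (k + 1 ≤ n) := by lia
          simp [σ, h', h'']
      let d : Cofan (fun k ↦ (H i).obj (F.obj k)) :=
        Cofan.mk ((H i).obj (∐ F.obj)) (fun k ↦ (H i).map (Sigma.ι F.obj k))
      have hd : IsColimit d := isColimitCofanMkObjOfIsColimit (H i) _ _
        (coproductIsCoproduct F.obj)
      rw [ModuleCat.mono_iff_injective, injective_iff_map_eq_zero]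
      intro x hx
      refine eq_zero_of_components_eq_zero hd (fun n ↦ (H i).map (φ ≫ σ n)) (fun n ↦ ?_)
        (fun k n hkn ↦ ?_) x (fun n ↦ ?_)
      · change (H i).map _ ≫ _ = _
        rw [← Functor.map_comp, hσ₁]
        exact (H i).map_id _
      · change (H i).map _ ≫ _ = _
        rw [← Functor.map_comp, hσ₂ _ _ hkn, Functor.map_zero]
      · rw [Functor.map_comp, ModuleCat.comp_apply]
        exact (congr_arg _ hx).trans (map_zero _)
    have hex : (ShortComplex.mk ((H i).map φ) ((H i).map p)
        (by rw [← Functor.map_comp, hφp, Functor.map_zero])).Exact :=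
      DerivedCategory.HomologySequence.exact₂ _ hT i
    have : Epi ((H i).map p) :=
      (DerivedCategory.HomologySequence.epi_homologyMap_mor₂_iff _ hT i (i + 1) rfl).2
        ((DerivedCategory.HomologySequence.mono_homologyMap_mor₁_iff _ hT i (i + 1) rfl).1
          (hmono (i + 1)))
    have hd := isColimitCofanMkObjOfIsColimit (H i) _ _ (coproductIsCoproduct F.obj)
    have hdesc (s : Cocone (F ⋙ H i)) : ∃ g : (H i).obj L ⟶ s.pt,
        ∀ k, (H i).map (Sigma.ι F.obj k) ≫ (H i).map p ≫ g = s.ι.app k := by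
      let g₀ : (H i).obj (∐ F.obj) ⟶ s.pt := Cofan.IsColimit.desc hd (fun k ↦ s.ι.app k)
      have hg₀ (k : ℕ) : (H i).map (Sigma.ι F.obj k) ≫ g₀ = s.ι.app k :=
        Cofan.IsColimit.fac hd _ k
      have h0 : (H i).map φ ≫ g₀ = 0 := by
        refine Cofan.IsColimit.hom_ext hd _ _ fun k ↦ ?_
        change (H i).map (Sigma.ι F.obj k) ≫ _ = (H i).map (Sigma.ι F.obj k) ≫ _
        rw [← Functor.map_comp_assoc, hφ, Functor.map_sub, Preadditive.sub_comp, hg₀,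
          Functor.map_comp, Category.assoc, hg₀, comp_zero, sub_eq_zero]
        exact (s.w (homOfLE k.le_succ)).symm
      have : Epi (ShortComplex.mk ((H i).map φ) ((H i).map p)
          (by rw [← Functor.map_comp, hφp, Functor.map_zero])).g := this
      refine ⟨hex.desc g₀ h0, fun k ↦ ?_⟩
      have := hex.g_desc g₀ h0
      rw [← hg₀]
      exact congr_arg _ this
    choose g hg using hdesc
    refine ⟨{ desc := g, fac := fun s k ↦ ?_, uniq := fun s m hm ↦ ?_ }⟩
    · rw [← hg s k]
      simp [hc, H]
    · rw [← cancel_epi ((H i).map p)]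
      refine Cofan.IsColimit.hom_ext hd _ _ fun k ↦ ?_
      refine Eq.trans ?_ (hg s k).symm
      rw [← hm k]
      simp [hc, H]
  · have h : S (∐ F.obj) := hS.coproduct_nat (coproductIsCoproduct F.obj) hF
    exact hS.extension _ (rot_of_distTriang _ hT) h (hS.shift _ h 1 one_pos)

end

/-! ### Homology-exact resolutions and pre-aisles -/

section

section Preaisle

variable {C : Type*} [Category* C] [Preadditive C] [HasZeroObject C] [HasShift C ℤ]
  [∀ n : ℤ, (shiftFunctor C n).Additive] [Pretriangulated C] {S : ObjectProperty C}

theorem IsCocompletePreaisle.of_isZero (hS : IsCocompletePreaisle.{u} S) {X : C} (hX : IsZero X) :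
    S X :=
  hS.coproduct PEmpty (fun x ↦ x.elim) (Cofan.mk X (fun x ↦ x.elim))
    ⟨Cofan.IsColimit.mk _ (fun _ ↦ 0) (fun _ j ↦ j.elim) (fun _ _ _ ↦ hX.eq_of_src _ _)⟩
    (fun x ↦ x.elim)

theorem IsCocompletePreaisle.shift_nat (hS : IsCocompletePreaisle.{u} S) {X : C} (hX : S X)
    (k : ℕ) : S (X⟦(k : ℤ)⟧) := by
  obtain rfl | hk := Nat.eq_zero_or_pos k
  · exact hS.of_iso ((shiftFunctorZero C ℤ).symm.app X) hX
  · exact hS.shift X hX k (by lia)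

theorem IsCocompletePreaisle.of_triangle₂ (hS : IsCocompletePreaisle.{u} S) {X Y Z : C}
    {f : X ⟶ Y} {g : Y ⟶ Z} {h : Z ⟶ X⟦(1 : ℤ)⟧} (hT : Triangle.mk f g h ∈ distTriang C)
    (hX : S X) (hZ : S Z) : S Y :=
  hS.extension _ hT hX hZ

theorem IsCocompletePreaisle.of_triangle₃ (hS : IsCocompletePreaisle.{u} S) {X Y Z : C}
    {f : X ⟶ Y} {g : Y ⟶ Z} {h : Z ⟶ X⟦(1 : ℤ)⟧} (hT : Triangle.mk f g h ∈ distTriang C)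
    (hX : S X) (hY : S Y) : S Z :=
  hS.extension _ (rot_of_distTriang _ hT) hY (hS.shift _ hX 1 one_pos)

end Preaisle

variable {A : Type u} [Ring A] [HasDerivedCategory.{w} (ModuleCat.{u} A)]
  {S : ObjectProperty (DerivedCategory (ModuleCat.{u} A))}

theorem homologyFunctor_map_shift_eq_zero {X Y : DerivedCategory (ModuleCat.{u} A)} (f : X ⟶ Y)
    (hf : ∀ i, (DerivedCategory.homologyFunctor (ModuleCat.{u} A) i).map f = 0) (m i : ℤ) :
    (DerivedCategory.homologyFunctor (ModuleCat.{u} A) i).map (f⟦m⟧') = 0 := by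
  have := ((DerivedCategory.homologyFunctor (ModuleCat.{u} A) 0).shiftIso m i (m + i)
    rfl).hom.naturality f
  exact (cancel_mono (((DerivedCategory.homologyFunctor (ModuleCat.{u} A) 0).shiftIso m i (m + i)
    rfl).hom.app Y)).1 (this.trans ((congr_arg _ (hf (m + i))).trans
      (comp_zero.trans zero_comp.symm)))

/-- One step of the tower: the triangle `K ⟶ G ⟶ K₀ ⟶ K⟦1⟧`, shifted `m` times and rotated. -/
theorem exists_shifted_resolution_step {K₀ K G Z : DerivedCategory (ModuleCat.{u} A)} {f : K ⟶ G}
    {g : G ⟶ K₀} {δ : K₀ ⟶ K⟦(1 : ℤ)⟧} (hT : Triangle.mk f g δ ∈ distTriang _)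
    (hδ : ∀ i, (DerivedCategory.homologyFunctor (ModuleCat.{u} A) i).map δ = 0) (m : ℤ)
    (e : Z ≅ K₀⟦m⟧) :
    ∃ (Z' : DerivedCategory (ModuleCat.{u} A)) (p : G⟦m⟧ ⟶ Z) (b : Z ⟶ Z')
      (q : Z' ⟶ G⟦m⟧⟦(1 : ℤ)⟧), Triangle.mk p b q ∈ distTriang _ ∧ Nonempty (Z' ≅ K⟦m + 1⟧) ∧
        ∀ i, (DerivedCategory.homologyFunctor (ModuleCat.{u} A) i).map b = 0 := by
  let D := (Triangle.shiftFunctor _ m).obj (Triangle.mk f g δ)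
  have hD : D.rotate ∈ distTriang _ :=
    rot_of_distTriang _ (Triangle.shift_distinguished _ hT m)
  refine ⟨K⟦m⟧⟦(1 : ℤ)⟧, D.mor₂ ≫ e.inv, e.hom ≫ D.mor₃, D.rotate.mor₃,
    distinguished_of_iso₂ hD e,
    ⟨(shiftFunctorAdd _ m 1).symm.app K⟩, fun i ↦ ?_⟩
  · have h₃ : D.mor₃ = m.negOnePow • (δ⟦m⟧' ≫ (shiftFunctorComm _ 1 m).hom.app K) := rfl
    have h0 := homologyFunctor_map_shift_eq_zero δ hδ m i
    have h1 : (DerivedCategory.homologyFunctor (ModuleCat.{u} A) i).map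
        (δ⟦m⟧' ≫ (shiftFunctorComm _ 1 m).hom.app K) = 0 := by
      rw [Functor.map_comp, h0, zero_comp]
    rw [h₃, Functor.map_comp]
    obtain h | h := Int.units_eq_one_or m.negOnePow
    · rw [h, one_smul, h1, comp_zero]
    · rw [h, Units.neg_smul, one_smul, Functor.map_neg, h1, neg_zero, comp_zero]

/-- The state after `m` steps of a resolution of `X` by objects of `S` whose syzygies satisfy `P`:
a triangle `Y ⟶ X ⟶ Z ⟶ Y⟦1⟧` where `Y` is built from the first `m` terms of the resolution and `Z`
is the `m`-th shift of a syzygy. -/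
structure ResolutionStage (S P : ObjectProperty (DerivedCategory (ModuleCat.{u} A)))
    (X : DerivedCategory (ModuleCat.{u} A)) (m : ℕ) where
  /-- the partial resolution -/
  Y : DerivedCategory (ModuleCat.{u} A)
  /-- the shifted syzygy -/
  Z : DerivedCategory (ModuleCat.{u} A)
  /-- the augmentation -/
  u : Y ⟶ X
  /-- the projection to the cone of the augmentation -/
  v : X ⟶ Z
  /-- the connecting morphism -/
  w : Z ⟶ Y⟦(1 : ℤ)⟧
  distinguished : Triangle.mk u v w ∈ distTriang _
  mem : S Y
  exists_iso : ∃ K, P K ∧ Nonempty (Z ≅ K⟦(m : ℤ)⟧)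

/-- The octahedral axiom adds one more term of the resolution to a stage. The map between the
shifted syzygies is zero on homology, which is what makes the tower of the `Y` converge to `X`. -/
theorem ResolutionStage.exists_next (hS : IsCocompletePreaisle.{u} S)
    {P : ObjectProperty (DerivedCategory (ModuleCat.{u} A))}
    (hP : ∀ X, P X → ∃ (K G : DerivedCategory (ModuleCat.{u} A)) (f : K ⟶ G) (g : G ⟶ X)
      (δ : X ⟶ K⟦(1 : ℤ)⟧), Triangle.mk f g δ ∈ distTriang _ ∧ S G ∧ P K ∧
        ∀ i, (DerivedCategory.homologyFunctor (ModuleCat.{u} A) i).map δ = 0)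
    {X : DerivedCategory (ModuleCat.{u} A)} {m : ℕ} (s : ResolutionStage S P X m) :
    ∃ (s' : ResolutionStage S P X (m + 1)) (a : s.Y ⟶ s'.Y) (b : s.Z ⟶ s'.Z),
      a ≫ s'.u = s.u ∧ s.v ≫ b = s'.v ∧ s.w ≫ a⟦(1 : ℤ)⟧' = b ≫ s'.w ∧
        ∀ i, (DerivedCategory.homologyFunctor (ModuleCat.{u} A) i).map b = 0 := by
  obtain ⟨K₀, hK₀, ⟨e⟩⟩ := s.exists_iso
  obtain ⟨K, G, f, g, δ, hT, hG, hK, hδ⟩ := hP K₀ hK₀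
  obtain ⟨Z', p, b, q, hT', ⟨e'⟩, hb⟩ := exists_shifted_resolution_step hT hδ m e
  obtain ⟨Y', u', w', hT''⟩ := distinguished_cocone_triangle₁ (s.v ≫ b)
  let o := someOctahedron' rfl s.distinguished hT' hT''
  exact ⟨⟨Y', Z', u', s.v ≫ b, w', hT'', hS.of_triangle₂ o.mem s.mem (hS.shift_nat hG m),
    K, hK, ⟨e'.trans (eqToIso (by push_cast; rfl))⟩⟩, o.m₁, b, o.comm₁, rfl, o.comm₂, hb⟩

open scoped ZeroObject in
/-- If every object `X` with the property `P` is the end of a triangle `K ⟶ G ⟶ X ⟶ K⟦1⟧` that is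
short exact on homology, with `G` in the cocomplete pre-aisle `S` and `K` again with the
property `P`, then all objects with the property `P` lie in `S`: splicing the triangles writes `X`
as the homotopy colimit of iterated extensions of the objects `G`. -/
theorem IsCocompletePreaisle.of_homologyExact_resolution (hS : IsCocompletePreaisle.{u} S)
    {P : ObjectProperty (DerivedCategory (ModuleCat.{u} A))}
    (hP : ∀ X, P X → ∃ (K G : DerivedCategory (ModuleCat.{u} A)) (f : K ⟶ G) (g : G ⟶ X)
      (δ : X ⟶ K⟦(1 : ℤ)⟧), Triangle.mk f g δ ∈ distTriang _ ∧ S G ∧ P K ∧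
        ∀ i, (DerivedCategory.homologyFunctor (ModuleCat.{u} A) i).map δ = 0) : P ≤ S := by
  intro X hX
  choose next a b ha hab haw hb using
    fun (m : ℕ) (s : ResolutionStage S P X m) ↦ s.exists_next hS hP
  let s₀ : ResolutionStage S P X 0 :=
    { Y := 0, Z := X, u := 0, v := 𝟙 X, w := 0
      distinguished := contractible_distinguished₁ X
      mem := hS.of_isZero (isZero_zero _)
      exists_iso := ⟨X, hX, ⟨(shiftFunctorZero _ ℤ).symm.app X⟩⟩ }
  let s (m : ℕ) : ResolutionStage S P X m := Nat.rec s₀ (fun m s ↦ next m s) m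
  let F : ℕ ⥤ DerivedCategory (ModuleCat.{u} A) :=
    Functor.ofSequence (X := fun m ↦ (s m).Y) (fun m ↦ a m (s m))
  have hF (m : ℕ) : F.map (homOfLE m.le_succ) = a m (s m) := Functor.ofSequence_map_homOfLE_succ _ m
  obtain ⟨c, hdesc, hcolim, hmem⟩ := exists_homotopyColimit F
  let c' : Cocone F :=
    { pt := X
      ι := NatTrans.ofSequence (fun m ↦ (s m).u) (fun m ↦ by
        exact (hF m =≫ _).trans ((ha m (s m)).trans (Category.comp_id _).symm)) }
  obtain ⟨g, hg⟩ := hdesc c'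
  have hg (m : ℕ) : c.ι.app m ≫ g = (s m).u := hg m
  have hLS : S c.pt := hmem S hS (fun m ↦ (s m).mem)
  suffices IsIso g from hS.of_iso (asIso g) hLS
  rw [DerivedCategory.isIso_iff]
  intro i
  let H := DerivedCategory.homologyFunctor (ModuleCat.{u} A)
  have hHg (m : ℕ) (y : (H i).obj (s m).Y) :
      (H i).map g ((H i).map (c.ι.app m) y) = (H i).map (s m).u y := by
    have : (H i).map (c.ι.app m) ≫ (H i).map g = (H i).map (s m).u :=
      ((H i).map_comp _ _).symm.trans (congr_arg _ (hg m))
    exact congr_arg (fun f ↦ f y) this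
  have := preservesSmallestFilteredColimits_of_preservesFilteredColimits (forget (ModuleCat.{u} A))
  rw [ConcreteCategory.isIso_iff_bijective]
  constructor
  -- a class of the `m`-th stage which dies in `X` comes from the syzygy, hence dies in the next
  -- stage
  · refine (injective_iff_map_eq_zero _).2 fun x hx ↦ ?_
    obtain ⟨m, y, rfl⟩ := Concrete.isColimit_exists_rep _ (hcolim i).some x
    have hy : (H i).map (s m).u y = 0 := (hHg m y).symm.trans hx
    have hex := (ShortComplex.moduleCat_exact_iff _).1
      (DerivedCategory.HomologySequence.exact₁ _ (s m).distinguished (i - 1) i (by lia))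
    obtain ⟨z, hz⟩ := hex y hy
    let φ : Triangle.mk (s m).u (s m).v (s m).w ⟶
        Triangle.mk (s (m + 1)).u (s (m + 1)).v (s (m + 1)).w :=
      Triangle.homMk _ _ (a m (s m)) (𝟙 X) (b m (s m))
        ((Category.comp_id _).trans (ha m (s m)).symm)
        ((hab m (s m)).trans (Category.id_comp _).symm) (haw m (s m))
    have hφ := (H 0).homologySequenceδ_naturality _ _ φ (i - 1) i (by lia)
    have h0 : (H i).map (a m (s m)) y = 0 := by
      rw [← hz]
      have := congr_arg (fun f ↦ f z) hφ
      refine Eq.trans this.symm ?_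
      have hb' : ((H 0).shift (i - 1)).map φ.hom₃ = 0 := hb m (s m) (i - 1)
      rw [hb', zero_comp]
      rfl
    have : a m (s m) ≫ c.ι.app (m + 1) = c.ι.app m :=
      (hF m =≫ _).symm.trans (c.w _)
    have : (H i).map (a m (s m)) ≫ (H i).map (c.ι.app (m + 1)) = (H i).map (c.ι.app m) :=
      ((H i).map_comp _ _).symm.trans (congr_arg _ this)
    refine (congr_arg (fun f ↦ f y) this).symm.trans ?_
    exact (congr_arg ((H i).map (c.ι.app (m + 1))).hom h0).trans (map_zero _)
  -- the first stage is already surjective on homology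
  · intro x
    have hex := (ShortComplex.moduleCat_exact_iff _).1
      (DerivedCategory.HomologySequence.exact₂ _ (s 1).distinguished i)
    have hv : (H i).map (s 1).v = 0 := by
      have : (s 0).v ≫ b 0 (s 0) = (s 1).v := hab 0 (s 0)
      rw [← this, Functor.map_comp, hb, comp_zero]
    obtain ⟨y, hy⟩ := hex x (congr_arg (fun f ↦ f x) hv)
    exact ⟨(H i).map (c.ι.app 1) y, (hHg 1 y).trans hy⟩

end

/-! ### Directed colimits and pre-aisles -/

section

section DirectedResolution

universe v' u'

variable {J : Type u} [Preorder J] {D : Type u'} [Category.{v'} D] [HasColimitsOfSize.{u, u} D]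
  (F : J ⥤ D)

/-- The coproduct over `j` of the functors freely generated by `F.obj j` at `j`. -/
noncomputable abbrev freeCover : J ⥤ D :=
  ∐ fun j ↦ (evaluationLeftAdjoint D j).obj (F.obj j)

/-- The canonical morphism from the free cover. -/
noncomputable def freeCoverπ : freeCover F ⟶ F :=
  Sigma.desc fun j ↦ (evaluationAdjunctionRight D j).counit.app F

/-- The section, at the object `j`, of the canonical morphism from the free cover: the inclusion
in the summand freely generated at `j`. These sections are not natural in `j`. -/
noncomputable def freeCoverSection (j : J) : F.obj j ⟶ (freeCover F).obj j :=
  (evaluationAdjunctionRight D j).unit.app (F.obj j) ≫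
    (Sigma.ι (fun j ↦ (evaluationLeftAdjoint D j).obj (F.obj j)) j).app j

theorem freeCoverSection_comp (j : J) :
    freeCoverSection F j ≫ (freeCoverπ F).app j = 𝟙 _ := by
  have h : Sigma.ι (fun j ↦ (evaluationLeftAdjoint D j).obj (F.obj j)) j ≫ freeCoverπ F =
    (evaluationAdjunctionRight D j).counit.app F := by simp [freeCoverπ]
  rw [freeCoverSection, Category.assoc, ← NatTrans.comp_app, h]
  exact (evaluationAdjunctionRight D j).right_triangle_components F

/-- The functor freely generated by `X` at `j` has colimit `X`. -/
noncomputable def colimEvaluationLeftAdjointIso (j : J) :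
    evaluationLeftAdjoint D j ⋙ (colim : (J ⥤ D) ⥤ D) ≅ 𝟭 D :=
  Adjunction.leftAdjointUniq ((evaluationAdjunctionRight D j).comp colimConstAdj)
    (Adjunction.id.ofNatIsoRight (Iso.refl _))

end DirectedResolution

variable {A : Type u} [Ring A] [HasDerivedCategory.{w} (ModuleCat.{u} A)]
  {S : ObjectProperty (DerivedCategory (ModuleCat.{u} A))}

theorem IsCocompletePreaisle.Q_cofan (hS : IsCocompletePreaisle.{u} S) {J : Type u}
    {F : J → CochainComplex (ModuleCat.{u} A) ℤ} {c : Cofan F} (hc : IsColimit c)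
    (hF : ∀ j, S (DerivedCategory.Q.obj (F j))) : S (DerivedCategory.Q.obj c.pt) := by
  have := preservesColimitsOfShape_Q (C := ModuleCat.{u} A) J
  let e : c ≅ Cofan.mk c.pt c.inj := Cofan.ext (Iso.refl _) (fun _ ↦ Category.comp_id _)
  exact hS.coproduct J _ _ ⟨isColimitCofanMkObjOfIsColimit DerivedCategory.Q _ _
    (hc.ofIsoColimit e)⟩ hF

theorem IsCocompletePreaisle.Q_sigma (hS : IsCocompletePreaisle.{u} S) {J : Type u}
    {F : J → CochainComplex (ModuleCat.{u} A) ℤ}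
    (hF : ∀ j, S (DerivedCategory.Q.obj (F j))) : S (DerivedCategory.Q.obj (∐ F)) :=
  hS.Q_cofan (coproductIsCoproduct F) hF

theorem IsCocompletePreaisle.of_shortExact₃ (hS : IsCocompletePreaisle.{u} S)
    {s : ShortComplex (CochainComplex (ModuleCat.{u} A) ℤ)} (hs : s.ShortExact)
    (h₁ : S (DerivedCategory.Q.obj s.X₁)) (h₂ : S (DerivedCategory.Q.obj s.X₂)) :
    S (DerivedCategory.Q.obj s.X₃) :=
  hS.of_triangle₃ (DerivedCategory.triangleOfSES_distinguished hs) h₁ h₂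

/-- In a split exact sequence the first object is also a cokernel of a monomorphism from the third
to the second, and pre-aisles are closed under such cokernels. -/
theorem IsCocompletePreaisle.of_splitting₁ (hS : IsCocompletePreaisle.{u} S)
    {s : ShortComplex (CochainComplex (ModuleCat.{u} A) ℤ)} (σ : s.Splitting)
    (h₂ : S (DerivedCategory.Q.obj s.X₂)) (h₃ : S (DerivedCategory.Q.obj s.X₃)) :
    S (DerivedCategory.Q.obj s.X₁) := by
  let s' : ShortComplex (CochainComplex (ModuleCat.{u} A) ℤ) := ShortComplex.mk σ.s σ.r σ.s_r
  have σ' : s'.Splitting := ⟨s.g, s.f, σ.s_g, σ.f_r, by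
    rw [add_comm]; exact σ.id⟩
  exact hS.of_shortExact₃ σ'.shortExact h₃ h₂

theorem homologyFunctor_map_triangleOfSESδ_eq_zero
    {s : ShortComplex (CochainComplex (ModuleCat.{u} A) ℤ)} (hs : s.ShortExact) (i : ℤ)
    [Epi (HomologicalComplex.homologyMap s.g i)] :
    (DerivedCategory.homologyFunctor (ModuleCat.{u} A) i).map
      (DerivedCategory.triangleOfSESδ hs) = 0 := by
  have : Epi ((DerivedCategory.homologyFunctor (ModuleCat.{u} A) i).map
      (DerivedCategory.Q.map s.g)) :=
    ((MorphismProperty.epimorphisms _).arrow_mk_iso_iff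
      (((Functor.mapArrowFunctor _ _).mapIso
        (DerivedCategory.homologyFunctorFactors (ModuleCat.{u} A) i)).app (Arrow.mk s.g))).2
      (inferInstanceAs (Epi (HomologicalComplex.homologyMap s.g i)))
  have h := comp_eq_zero₂₃ (DerivedCategory.triangleOfSES_distinguished hs)
  rw [← cancel_epi ((DerivedCategory.homologyFunctor (ModuleCat.{u} A) i).map
      (DerivedCategory.Q.map s.g)), ← Functor.map_comp, h, Functor.map_zero, comp_zero]

variable {J : Type u} [LinearOrder J] [Nonempty J]

/-- A cocomplete pre-aisle is closed under directed colimits of complexes: the colimit of `F` is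
resolved by coproducts of the values of `F`, and this resolution is short exact on homology. -/
theorem IsCocompletePreaisle.Q_colimit (hS : IsCocompletePreaisle.{u} S)
    (F : J ⥤ CochainComplex (ModuleCat.{u} A) ℤ)
    (hF : ∀ j, S (DerivedCategory.Q.obj (F.obj j))) :
    S (DerivedCategory.Q.obj (colimit F)) := by
  let P : ObjectProperty (DerivedCategory (ModuleCat.{u} A)) := fun X ↦
    ∃ F : J ⥤ CochainComplex (ModuleCat.{u} A) ℤ, (∀ j, S (DerivedCategory.Q.obj (F.obj j))) ∧
      Nonempty (X ≅ DerivedCategory.Q.obj (colimit F))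
  refine hS.of_homologyExact_resolution (P := P) ?_ _ ⟨F, hF, ⟨Iso.refl _⟩⟩
  rintro X ⟨F, hF, ⟨e⟩⟩
  have : ∀ j, Epi ((freeCoverπ F).app j) := fun j ↦
    (SplitEpi.mk _ (freeCoverSection_comp F j)).epi
  have : Epi (freeCoverπ F) := NatTrans.epi_of_epi_app _
  let s : ShortComplex (J ⥤ CochainComplex (ModuleCat.{u} A) ℤ) :=
    ShortComplex.mk (kernel.ι (freeCoverπ F)) (freeCoverπ F) (kernel.condition _)
  have hs : s.ShortExact :=
    { exact := ShortComplex.exact_of_f_is_kernel _ (kernelIsKernel (freeCoverπ F)) }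
  have hs' := hs.map_of_exact (colim : (J ⥤ CochainComplex (ModuleCat.{u} A) ℤ) ⥤ _)
  -- the values of the free cover and its colimit are coproducts of objects `F.obj k`
  have hcover (j : J) : S (DerivedCategory.Q.obj ((freeCover F).obj j)) := by
    have hc := isColimitCofanMkObjOfIsColimit ((evaluation J _).obj j) _ _
      (coproductIsCoproduct fun j ↦ (evaluationLeftAdjoint _ j).obj (F.obj j))
    exact hS.Q_cofan hc (fun k ↦ hS.Q_sigma (fun _ ↦ hF k))
  have hK (j : J) : S (DerivedCategory.Q.obj ((kernel (freeCoverπ F)).obj j)) := by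
    have hsj := hs.map_of_exact ((evaluation J _).obj j)
    exact hS.of_splitting₁ (ShortComplex.Splitting.ofExactOfSection _ hsj.exact
      (freeCoverSection F j) (freeCoverSection_comp F j) hsj.mono_f) (hcover j) (hF j)
  have hcolim : S (DerivedCategory.Q.obj (colimit (freeCover F))) := by
    have hc := isColimitCofanMkObjOfIsColimit colim _ _
      (coproductIsCoproduct fun j ↦ (evaluationLeftAdjoint _ j).obj (F.obj j))
    exact hS.Q_cofan hc (fun k ↦ hS.of_iso (DerivedCategory.Q.mapIso
      ((colimEvaluationLeftAdjointIso k).symm.app (F.obj k))) (hF k))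
  -- the homology of the colimit is exhausted by the homology of the `F.obj j`, which lifts
  have hepi (i : ℤ) : Epi (HomologicalComplex.homologyMap (colim.map (freeCoverπ F)) i) := by
    have := preservesColimitsOfShape_homologyFunctor (J := J) (C := ModuleCat.{u} A)
      (ComplexShape.up ℤ) i
    have hc := isColimitOfPreserves (HomologicalComplex.homologyFunctor (ModuleCat.{u} A)
      (ComplexShape.up ℤ) i) (colimit.isColimit F)
    refine ⟨fun a b hab ↦ hc.hom_ext fun j ↦ ?_⟩
    have h : colimit.ι F j =
        (freeCoverSection F j ≫ colimit.ι _ j) ≫ colim.map (freeCoverπ F) := by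
      simp [reassoc_of% freeCoverSection_comp F j]
    let H := HomologicalComplex.homologyFunctor (ModuleCat.{u} A) (ComplexShape.up ℤ) i
    have hH : H.map (colimit.ι F j) = H.map (freeCoverSection F j ≫ colimit.ι _ j) ≫
        H.map (colim.map (freeCoverπ F)) := (congr_arg H.map h).trans (H.map_comp _ _)
    refine (hH =≫ a).trans (.trans ?_ (hH =≫ b).symm)
    exact (Category.assoc _ _ _).trans ((congr_arg _ hab).trans (Category.assoc _ _ _).symm)
  have hT := DerivedCategory.triangleOfSES_distinguished hs'
  have hδ (i : ℤ) := by
    have : Epi (HomologicalComplex.homologyMap (s.map colim).g i) := hepi i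
    exact homologyFunctor_map_triangleOfSESδ_eq_zero hs' i
  have e : X ≅ DerivedCategory.Q.obj (s.map colim).X₃ := e
  refine ⟨_, _, _, _, _, distinguished_of_iso₃ hT e, hcolim,
    ⟨kernel (freeCoverπ F), hK, ⟨Iso.refl _⟩⟩, fun i ↦ ?_⟩
  exact ((DerivedCategory.homologyFunctor _ i).map_comp _ _).trans
    ((congr_arg _ (hδ i)).trans comp_zero)

end

/-! ### Approximation triangles from the small object argument -/

section

section

variable {C : Type*} [Category* C] [Preadditive C] [HasZeroObject C] [HasShift C ℤ]
  [∀ n : ℤ, (shiftFunctor C n).Additive] [Pretriangulated C] {S : ObjectProperty C}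

theorem nonempty_iso₃ {X Y Z Z' : C} {f : X ⟶ Y} {g : Y ⟶ Z} {h : Z ⟶ X⟦(1 : ℤ)⟧}
    {g' : Y ⟶ Z'} {h' : Z' ⟶ X⟦(1 : ℤ)⟧} (hT : Triangle.mk f g h ∈ distTriang C)
    (hT' : Triangle.mk f g' h' ∈ distTriang C) : Nonempty (Z ≅ Z') :=
  ⟨Triangle.π₃.mapIso (isoTriangleOfIso₁₂ _ _ hT hT' (Iso.refl _) (Iso.refl _)
    ((Category.comp_id _).trans (Category.id_comp _).symm))⟩

theorem IsCocompletePreaisle.shift_property (hS : IsCocompletePreaisle.{u} S) (n : ℤ) :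
    IsCocompletePreaisle.{u} (S.shift n) where
  of_iso e hX := hS.of_iso ((shiftFunctor C n).mapIso e) hX
  shift X hX i hi := hS.of_iso (shiftComm X n i) (hS.shift _ hX i hi)
  extension D hD h₁ h₃ := hS.extension _ (Triangle.shift_distinguished D hD n) h₁ h₃
  coproduct J F c hc hF := by
    let e : c ≅ Cofan.mk c.pt c.inj := Cofan.ext (Iso.refl _) (fun _ ↦ Category.comp_id _)
    exact hS.coproduct J _ _ ⟨isColimitCofanMkObjOfIsColimit (shiftFunctor C n) _ _
      (hc.some.ofIsoColimit e)⟩ hF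

end

variable {A : Type u} [Ring A] [HasDerivedCategory.{w} (ModuleCat.{u} A)]
  {S : ObjectProperty (DerivedCategory (ModuleCat.{u} A))}

/-- The monomorphisms of complexes whose cokernel, regarded in `D(A)`, lies in `S`. -/
def monoWithCokernel (S : ObjectProperty (DerivedCategory (ModuleCat.{u} A))) :
    MorphismProperty (CochainComplex (ModuleCat.{u} A) ℤ) :=
  fun _ _ f ↦ Mono f ∧ S (DerivedCategory.Q.obj (cokernel f))

theorem shortExact_cokernel {C : Type*} [Category* C] [Abelian C] {X Y : C} (f : X ⟶ Y) [Mono f] :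
    (ShortComplex.mk f (cokernel.π f) (cokernel.condition f)).ShortExact :=
  { exact := ShortComplex.exact_of_g_is_cokernel _ (cokernelIsCokernel f) }

theorem monoWithCokernel_iff_of_triangle (hS : IsCocompletePreaisle.{u} S)
    {X Y : CochainComplex (ModuleCat.{u} A) ℤ} (f : X ⟶ Y) [Mono f]
    {Z : DerivedCategory (ModuleCat.{u} A)} {g : DerivedCategory.Q.obj Y ⟶ Z}
    {h : Z ⟶ (DerivedCategory.Q.obj X)⟦(1 : ℤ)⟧}
    (hT : Triangle.mk (DerivedCategory.Q.map f) g h ∈ distTriang _) :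
    monoWithCokernel S f ↔ S Z := by
  obtain ⟨e⟩ := nonempty_iso₃ hT
    (DerivedCategory.triangleOfSES_distinguished (shortExact_cokernel f))
  exact ⟨fun hf ↦ hS.of_iso e.symm hf.2, fun h ↦ ⟨inferInstance, hS.of_iso e h⟩⟩

theorem monoWithCokernel_iff_of_shortExact (hS : IsCocompletePreaisle.{u} S)
    {s : ShortComplex (CochainComplex (ModuleCat.{u} A) ℤ)} (hs : s.ShortExact) :
    monoWithCokernel S s.f ↔ S (DerivedCategory.Q.obj s.X₃) :=
  have := hs.mono_f
  monoWithCokernel_iff_of_triangle hS s.f (DerivedCategory.triangleOfSES_distinguished hs)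

theorem isomorphisms_le_monoWithCokernel (hS : IsCocompletePreaisle.{u} S) :
    MorphismProperty.isomorphisms _ ≤ monoWithCokernel S := by
  intro X Y f (hf : IsIso f)
  exact ⟨inferInstance, hS.of_isZero
    (DerivedCategory.Q.map_isZero (isZero_cokernel_of_epi f))⟩

theorem isMultiplicative_monoWithCokernel (hS : IsCocompletePreaisle.{u} S) :
    (monoWithCokernel S).IsMultiplicative where
  id_mem X := isomorphisms_le_monoWithCokernel hS _ (inferInstanceAs (IsIso (𝟙 X)))
  comp_mem f g hf hg := by
    have := hf.1
    have := hg.1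
    obtain ⟨Z, v, w, hT⟩ := distinguished_cocone_triangle (DerivedCategory.Q.map (f ≫ g))
    refine (monoWithCokernel_iff_of_triangle hS _ hT).2 ?_
    exact hS.of_triangle₂ (someOctahedron (DerivedCategory.Q.map_comp f g).symm
      (DerivedCategory.triangleOfSES_distinguished (shortExact_cokernel f))
      (DerivedCategory.triangleOfSES_distinguished (shortExact_cokernel g)) hT).mem hf.2 hg.2

theorem respectsIso_monoWithCokernel (hS : IsCocompletePreaisle.{u} S) :
    (monoWithCokernel S).RespectsIso :=
  have := isMultiplicative_monoWithCokernel hS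
  MorphismProperty.respectsIso_of_isStableUnderComposition (isomorphisms_le_monoWithCokernel hS)

theorem isStableUnderCobaseChange_monoWithCokernel (hS : IsCocompletePreaisle.{u} S) :
    (monoWithCokernel S).IsStableUnderCobaseChange where
  of_isPushout {X X' Y Y' f g f' g'} sq hf := by
    have := isIso_cokernel_map_of_isPushout sq.flip
    exact ⟨(MorphismProperty.monomorphisms _).of_isPushout sq hf.1,
      hS.of_iso (DerivedCategory.Q.mapIso (asIso (cokernel.map f f' g g' sq.w.symm))) hf.2⟩

/-- If `S` contains the colimits of diagrams of complexes of shape `J` with values in `S`, and these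
colimits are exact, then the monomorphisms with cokernel in `S` are stable under them. -/
theorem isStableUnderColimitsOfShape_monoWithCokernel (hS : IsCocompletePreaisle.{u} S)
    (J : Type*) [Category* J] [HasColimitsOfShape J (CochainComplex (ModuleCat.{u} A) ℤ)]
    [HasExactColimitsOfShape J (CochainComplex (ModuleCat.{u} A) ℤ)]
    (hJ : ∀ (F : J ⥤ CochainComplex (ModuleCat.{u} A) ℤ),
      (∀ j, S (DerivedCategory.Q.obj (F.obj j))) → S (DerivedCategory.Q.obj (colimit F))) :
    (monoWithCokernel S).IsStableUnderColimitsOfShape J where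
  condition X₁ X₂ c₁ c₂ h₁ h₂ f hf φ hφ := by
    have := respectsIso_monoWithCokernel hS
    have (j : J) : Mono (f.app j) := (hf j).1
    have : Mono f := NatTrans.mono_of_mono_app f
    have hs := shortExact_cokernel f
    have hc : monoWithCokernel S (colim.map f) :=
      (monoWithCokernel_iff_of_shortExact hS (hs.map_of_exact colim)).2
        (hJ _ (fun j ↦ (monoWithCokernel_iff_of_shortExact hS
          (hs.map_of_exact ((evaluation J _).obj j))).1 (hf j)))
    refine ((monoWithCokernel S).arrow_mk_iso_iff (Arrow.isoMk
      (h₁.coconePointUniqueUpToIso (colimit.isColimit X₁))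
      (h₂.coconePointUniqueUpToIso (colimit.isColimit X₂)) (h₁.hom_ext fun j ↦ ?_))).2 hc
    have e₁ := h₁.comp_coconePointUniqueUpToIso_hom (colimit.isColimit X₁) j
    have e₂ := h₂.comp_coconePointUniqueUpToIso_hom (colimit.isColimit X₂) j
    dsimp at e₁ e₂ ⊢
    rw [reassoc_of% e₁, reassoc_of% (hφ j), e₂]
    simp

theorem isStableUnderCoproducts_monoWithCokernel (hS : IsCocompletePreaisle.{u} S) :
    MorphismProperty.IsStableUnderCoproducts.{u} (monoWithCokernel S) where
  isStableUnderCoproductsOfShape J :=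
    isStableUnderColimitsOfShape_monoWithCokernel hS (Discrete J) (fun _ hF ↦
      hS.of_iso (DerivedCategory.Q.mapIso
        (HasColimit.isoOfNatIso Discrete.natIsoFunctor.symm)) (hS.Q_sigma (fun j ↦ hF ⟨j⟩)))

theorem isStableUnderTransfiniteCompositionOfShape_monoWithCokernel
    (hS : IsCocompletePreaisle.{u} S) (J : Type u) [LinearOrder J] [SuccOrder J] [OrderBot J]
    [WellFoundedLT J] :
    (monoWithCokernel S).IsStableUnderTransfiniteCompositionOfShape J := by
  have := isMultiplicative_monoWithCokernel hS
  have := respectsIso_monoWithCokernel hS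
  refine .of_isStableUnderColimitsOfShape (fun J _ _ _ _ ↦ ?_)
  exact isStableUnderColimitsOfShape_monoWithCokernel hS J (fun F hF ↦ hS.Q_colimit F hF)

/-- The inclusions of the nonnegative shifts of a complex `G` in their (contractible) cones. -/
noncomputable def coneInclusions (G : CochainComplex (ModuleCat.{u} A) ℤ) :
    MorphismProperty (CochainComplex (ModuleCat.{u} A) ℤ) :=
  MorphismProperty.ofHoms (fun k : ℕ ↦ CochainComplex.mappingCone.inr (𝟙 (G⟦(k : ℤ)⟧)))

instance (G : CochainComplex (ModuleCat.{u} A) ℤ) :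
    MorphismProperty.IsSmall.{u} (coneInclusions G) := by
  rw [coneInclusions]
  exact MorphismProperty.isSmall_ofHoms _

instance mono_mappingCone_inr {K L : CochainComplex (ModuleCat.{u} A) ℤ} (φ : K ⟶ L) :
    Mono (CochainComplex.mappingCone.inr φ) := by
  have (i : ℤ) : Mono ((CochainComplex.mappingCone.inr φ).f i) :=
    mono_of_mono_fac (CochainComplex.mappingCone.inr_f_snd_v φ i)
  exact HomologicalComplex.mono_of_mono_f _ this

theorem isZero_Q_mappingCone_id (K : CochainComplex (ModuleCat.{u} A) ℤ) :
    IsZero (DerivedCategory.Q.obj (CochainComplex.mappingCone (𝟙 K))) := by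
  have h := (HomotopyCategory.isZero_quotient_obj_iff _).2
    ⟨CochainComplex.mappingCone.homotopyToZeroOfId K⟩
  exact (DerivedCategory.Qh.map_isZero h).of_iso
    ((DerivedCategory.quotientCompQhIso (ModuleCat.{u} A)).symm.app _)

theorem coneInclusions_le_monoWithCokernel (hS : IsCocompletePreaisle.{u} S)
    {G : CochainComplex (ModuleCat.{u} A) ℤ}
    (hG : ∀ k : ℕ, S ((DerivedCategory.Q.obj (G⟦(k : ℤ)⟧))⟦(1 : ℤ)⟧)) :
    coneInclusions G ≤ monoWithCokernel S := by
  rintro _ _ _ ⟨k⟩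
  obtain ⟨Z, v, w, hT⟩ := distinguished_cocone_triangle
    (DerivedCategory.Q.map (CochainComplex.mappingCone.inr (𝟙 (G⟦(k : ℤ)⟧))))
  have : IsIso w := (Triangle.isZero₂_iff_isIso₃ _ hT).1 (isZero_Q_mappingCone_id _)
  exact (monoWithCokernel_iff_of_triangle hS _ hT).2 (hS.of_iso (asIso w).symm (hG k))

/-- All cells are attached along monomorphisms, and morphisms from `G⟦k⟧` commute with sufficiently
long colimits of monomorphisms in a Grothendieck category. -/
instance hasSmallObjectArgument_coneInclusions (G : CochainComplex (ModuleCat.{u} A) ℤ) :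
    MorphismProperty.HasSmallObjectArgument.{u} (coneInclusions G) := by
  obtain ⟨κ, hκ', hκ⟩ := HasCardinalLT.exists_regular_cardinal_forall.{u}
    (fun k : ℕ ↦ Subobject (G⟦(k : ℤ)⟧))
  have : Fact κ.IsRegular := ⟨hκ'⟩
  have : Nonempty κ.ord.ToType := by simpa using hκ'.ne_zero
  have := WellFoundedLT.toOrderBot κ.ord.ToType
  exact ⟨κ, inferInstance, inferInstance,
    { preservesColimit {A B X Y} i hi f hf := by
        let hf' : (MorphismProperty.monomorphisms _).TransfiniteCompositionOfShape κ.ord.ToType f :=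
          { toTransfiniteCompositionOfShape := hf.toTransfiniteCompositionOfShape
            map_mem j hj := by
              have := (hf.attachCells j hj).pushouts_coproducts
              simp only [MorphismProperty.ofHoms_homFamily] at this
              refine (?_ : _ ≤ MorphismProperty.monomorphisms _) _ this
              rw [MorphismProperty.pushouts_le_iff, MorphismProperty.coproducts_le_iff]
              rintro _ _ _ ⟨k⟩
              exact mono_mappingCone_inr (𝟙 (G⟦(k : ℤ)⟧)) }
        have (j j' : κ.ord.ToType) (φ : j ⟶ j') : Mono (hf'.F.map φ) := hf'.mem_map φ
        apply IsGrothendieckAbelian.preservesColimit_coyoneda_obj_of_mono (Y := hf'.F) (κ := κ)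
        obtain ⟨k⟩ := hi
        exact hκ k }⟩

open scoped ZeroObject in
/-- Attaching cones of shifts of `G` to a complex transfinitely often kills all morphisms from
these shifts. -/
theorem exists_monoWithCokernel_extension (hS : IsCocompletePreaisle.{u} S)
    {G : CochainComplex (ModuleCat.{u} A) ℤ}
    (hG : ∀ k : ℕ, S ((DerivedCategory.Q.obj (G⟦(k : ℤ)⟧))⟦(1 : ℤ)⟧))
    (X : CochainComplex (ModuleCat.{u} A) ℤ) :
    ∃ (V : CochainComplex (ModuleCat.{u} A) ℤ) (f : X ⟶ V), monoWithCokernel S f ∧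
      ∀ (k : ℕ) (φ : G⟦(k : ℤ)⟧ ⟶ V), ∃ ψ : CochainComplex.mappingCone (𝟙 (G⟦(k : ℤ)⟧)) ⟶ V,
        CochainComplex.mappingCone.inr _ ≫ ψ = φ := by
  -- `f` is the first half of the factorization of `X ⟶ 0`
  let I := coneInclusions G
  have : Fact I.smallObjectκ.IsRegular := MorphismProperty.smallObjectκ_isRegular I
  let f := SmallObject.ιObj I I.smallObjectκ (0 : X ⟶ 0)
  refine ⟨_, f, ?_, fun k φ ↦ ?_⟩
  · have := isStableUnderCobaseChange_monoWithCokernel hS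
    have := isStableUnderCoproducts_monoWithCokernel hS
    have := isStableUnderTransfiniteCompositionOfShape_monoWithCokernel hS I.smallObjectκ.ord.ToType
    have h : (MorphismProperty.coproducts.{u} I).pushouts ≤ monoWithCokernel S := by
      rw [MorphismProperty.pushouts_le_iff, MorphismProperty.coproducts_le_iff]
      exact coneInclusions_le_monoWithCokernel hS hG
    exact MorphismProperty.transfiniteCompositionsOfShape_le _ _ _
      (MorphismProperty.transfiniteCompositionsOfShape_monotone _ h _
        (SmallObject.transfiniteCompositionsOfShape_ιObj I I.smallObjectκ (0 : X ⟶ 0)))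
  · have hI : I (CochainComplex.mappingCone.inr (𝟙 (G⟦(k : ℤ)⟧))) := ⟨k⟩
    have := SmallObject.rlp_πObj I I.smallObjectκ (0 : X ⟶ 0) _ hI
    have sq : CommSq φ (CochainComplex.mappingCone.inr (𝟙 (G⟦(k : ℤ)⟧)))
      (SmallObject.πObj I I.smallObjectκ (0 : X ⟶ 0)) 0 := ⟨(isZero_zero _).eq_of_tgt _ _⟩
    exact ⟨sq.lift, sq.fac_left⟩

theorem Q_map_surjective_of_isKProjective (K L : CochainComplex (ModuleCat.{u} A) ℤ)
    [K.IsKProjective] (f : DerivedCategory.Q.obj K ⟶ DerivedCategory.Q.obj L) :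
    ∃ φ : K ⟶ L, DerivedCategory.Q.map φ = f := by
  let e := DerivedCategory.quotientCompQhIso (ModuleCat.{u} A)
  obtain ⟨g, hg⟩ := (CochainComplex.IsKProjective.Qh_map_bijective K
    ((HomotopyCategory.quotient _ _).obj L)).surjective (e.hom.app K ≫ f ≫ e.inv.app L)
  obtain ⟨φ, rfl⟩ := (HomotopyCategory.quotient _ _).map_surjective g
  refine ⟨φ, ?_⟩
  have h := e.hom.naturality φ
  have h' : DerivedCategory.Qh.map ((HomotopyCategory.quotient _ _).map φ) ≫ e.hom.app L =
      e.hom.app K ≫ DerivedCategory.Q.map φ := h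
  rw [hg] at h'
  rw [← cancel_epi (e.hom.app K), ← h']
  simp

/-- The approximation triangle: every object `X` is an extension of an object `V` that admits no
nonzero morphism from a nonnegative shift of the K-projective complex `G` by an object of a
cocomplete pre-aisle which contains `G`. -/
theorem IsCocompletePreaisle.exists_triangle (hS : IsCocompletePreaisle.{u} S)
    (G : CochainComplex (ModuleCat.{u} A) ℤ) [G.IsKProjective] (hG : S (DerivedCategory.Q.obj G))
    (X : DerivedCategory (ModuleCat.{u} A)) :
    ∃ (U V : DerivedCategory (ModuleCat.{u} A)) (f : U ⟶ X) (g : X ⟶ V) (h : V ⟶ U⟦(1 : ℤ)⟧),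
      Triangle.mk f g h ∈ distTriang _ ∧ S U ∧
        ∀ (k : ℕ) (a : (DerivedCategory.Q.obj G)⟦(k : ℤ)⟧ ⟶ V), a = 0 := by
  -- the cokernel of `X ⟶ V` has to lie in `S⟦1⟧`, as its desuspension is the fibre `U`
  let S' := S.shift (-1)
  have hS' : IsCocompletePreaisle.{u} S' := hS.shift_property (-1)
  let e (k : ℕ) : DerivedCategory.Q.obj (G⟦(k : ℤ)⟧) ≅ (DerivedCategory.Q.obj G)⟦(k : ℤ)⟧ :=
    (DerivedCategory.Q.commShiftIso (k : ℤ)).app G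
  have hG' (k : ℕ) : S' ((DerivedCategory.Q.obj (G⟦(k : ℤ)⟧))⟦(1 : ℤ)⟧) :=
    hS.of_iso ((shiftEquiv (DerivedCategory (ModuleCat.{u} A)) (1 : ℤ)).unitIso.app _)
      (hS.of_iso (e k).symm (hS.shift_nat hG k))
  obtain ⟨V, f, hf, hV⟩ := exists_monoWithCokernel_extension hS' hG'
    (DerivedCategory.Q.objPreimage X)
  have := hf.1
  have hT := inv_rot_of_distTriang _
    (DerivedCategory.triangleOfSES_distinguished (shortExact_cokernel f))
  refine ⟨_, _, _, _, _,
    distinguished_of_iso₂ hT (DerivedCategory.Q.objObjPreimageIso X).symm, hf.2, fun k a ↦ ?_⟩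
  obtain ⟨φ, hφ⟩ := Q_map_surjective_of_isKProjective (G⟦(k : ℤ)⟧) V ((e k).hom ≫ a)
  obtain ⟨ψ, rfl⟩ := hV k φ
  have h : (e k).hom ≫ a = 0 := by
    refine hφ.symm.trans ?_
    rw [Functor.map_comp, (isZero_Q_mappingCone_id _).eq_of_tgt (DerivedCategory.Q.map _) 0,
      zero_comp]
    rfl
  exact (cancel_epi (e k).hom).1 (h.trans comp_zero.symm)

end

/-! ### The t-structure generated by an object -/

section

theorem eq_zero_of_shift {C : Type*} [Category* C] [Preadditive C] [HasShift C ℤ]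
    [∀ n : ℤ, (shiftFunctor C n).Additive] {X Y : C} {m a k : ℤ} (h : m + a = k)
    (hXY : ∀ f : X⟦m⟧ ⟶ Y, f = 0) (f : X⟦k⟧ ⟶ Y⟦a⟧) : f = 0 := by
  obtain ⟨g, hg⟩ := (shiftFunctor C a).map_surjective ((shiftFunctorAdd' C m a k h).inv.app X ≫ f)
  rw [hXY g, Functor.map_zero] at hg
  exact (cancel_epi ((shiftFunctorAdd' C m a k h).inv.app X)).1 (hg.symm.trans comp_zero.symm)

section

variable {C : Type*} [Category* C] [Preadditive C] [HasZeroObject C] [HasShift C ℤ]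
  [∀ n : ℤ, (shiftFunctor C n).Additive] [Pretriangulated C]

theorem isCocompletePreaisle_generatedPreaisle (E : C) :
    IsCocompletePreaisle.{u} (generatedPreaisle.{u} E) where
  of_iso e hX P hP hE := hP.of_iso e (hX P hP hE)
  shift X hX i hi P hP hE := hP.shift X (hX P hP hE) i hi
  extension D hD h₁ h₃ P hP hE := hP.extension D hD (h₁ P hP hE) (h₃ P hP hE)
  coproduct J F c hc hF P hP hE := hP.coproduct J F c hc (fun j ↦ hF j P hP hE)

theorem generatedPreaisle_self (E : C) : generatedPreaisle.{u} E E := fun _ _ hE ↦ hE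

theorem IsCocompletePreaisle.isClosedUnderIsomorphisms {S : ObjectProperty C}
    (hS : IsCocompletePreaisle.{u} S) : S.IsClosedUnderIsomorphisms :=
  ⟨fun e h ↦ hS.of_iso e h⟩

/-- The objects none of whose nonnegative shifts admits a nonzero morphism to `Y` form a cocomplete
pre-aisle. -/
theorem isCocompletePreaisle_leftOrthogonal (Y : C) :
    IsCocompletePreaisle.{u} (fun X : C ↦ ∀ (k : ℤ), 0 ≤ k → ∀ f : X⟦k⟧ ⟶ Y, f = 0) where
  of_iso e hX k hk f := (cancel_epi ((shiftFunctor C k).mapIso e).hom).1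
    ((hX k hk _).trans comp_zero.symm)
  shift X hX i hi k hk f := (cancel_epi ((shiftFunctorAdd C i k).app X).hom).1
    ((hX (i + k) (by lia) _).trans comp_zero.symm)
  extension D hD h₁ h₃ k hk f := by
    obtain ⟨g, hg⟩ := Triangle.yoneda_exact₂ _ (Triangle.shift_distinguished D hD k) f
      (h₁ k hk _)
    rw [hg, h₃ k hk g]
    exact comp_zero
  coproduct J F c hc hF k hk f := by
    let e : c ≅ Cofan.mk c.pt c.inj := Cofan.ext (Iso.refl _) (fun _ ↦ Category.comp_id _)
    exact Cofan.IsColimit.hom_ext (isColimitCofanMkObjOfIsColimit (shiftFunctor C k) _ _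
      (hc.some.ofIsoColimit e)) _ _ fun j ↦ (hF j k hk _).trans (hF j k hk _).symm

theorem eq_zero_of_generatedPreaisle {E X Y : C} (hX : generatedPreaisle.{u} E X)
    (hY : ∀ (k : ℤ), 0 ≤ k → ∀ f : E⟦k⟧ ⟶ Y, f = 0) (f : X ⟶ Y) : f = 0 :=
  (cancel_epi ((shiftFunctorZero C ℤ).app X).hom).1
    ((hX _ (isCocompletePreaisle_leftOrthogonal Y) hY 0 le_rfl _).trans comp_zero.symm)

/-- Truncation triangles for the cocomplete pre-aisle generated by `E` make it the aisle of a
t-structure. -/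
theorem exists_tStructure_of_exists_triangle (E : C)
    (h : ∀ X : C, ∃ (U V : C) (f : U ⟶ X) (g : X ⟶ V) (h : V ⟶ U⟦(1 : ℤ)⟧),
      Triangle.mk f g h ∈ distTriang C ∧ generatedPreaisle.{u} E U ∧
        ∀ (k : ℤ), 0 ≤ k → ∀ a : E⟦k⟧ ⟶ V, a = 0) :
    ∃ t : TStructure C, IsGeneratedBy.{u} t E ∧
      t.ge 0 = fun X ↦ ∀ (k : ℤ), 0 < k → ∀ a : E⟦k⟧ ⟶ X, a = 0 := by
  have hP := isCocompletePreaisle_generatedPreaisle.{u} E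
  have := hP.isClosedUnderIsomorphisms
  let t : TStructure C :=
    { le n := (generatedPreaisle.{u} E).shift n
      ge n := fun X ↦ ∀ (k : ℤ), -n < k → ∀ a : E⟦k⟧ ⟶ X, a = 0
      ge_isClosedUnderIsomorphisms n :=
        ⟨fun e hX k hk a ↦ (cancel_mono e.inv).1 ((hX k hk _).trans zero_comp.symm)⟩
      le_shift n a n' h X hX := hP.of_iso ((shiftFunctorAdd' C a n' n h).app X) hX
      ge_shift n a n' h X hX k hk f :=
        eq_zero_of_shift (m := k - a) (by lia) (hX (k - a) (by lia)) f
      zero' X Y f hX hY := eq_zero_of_generatedPreaisle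
        (hP.of_iso ((shiftFunctorZero C ℤ).app X) hX) (fun k hk ↦ hY k (by lia)) f
      le_zero_le X hX := hP.shift _ (hP.of_iso ((shiftFunctorZero C ℤ).app X) hX) 1 one_pos
      ge_one_le X hX k hk := hX k (by lia)
      exists_triangle_zero_one X := by
        obtain ⟨U, V, f, g, h, hT, hU, hV⟩ := h X
        exact ⟨U, V, hP.of_iso ((shiftFunctorZero C ℤ).symm.app U) hU,
          fun k hk ↦ hV k (by lia), f, g, h, hT⟩ }
  exact ⟨t, (generatedPreaisle.{u} E).shift_zero ℤ, by simp [t]⟩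

end

theorem isKProjective_biprod {C : Type*} [Category* C] [Abelian C]
    (K L : CochainComplex C ℤ) [K.IsKProjective] [L.IsKProjective] : (K ⊞ L).IsKProjective where
  nonempty_homotopy_zero {M} f hM := by
    let h₁ := (CochainComplex.IsKProjective.homotopyZero (biprod.inl ≫ f) hM).compLeft
      (biprod.fst : K ⊞ L ⟶ K)
    let h₂ := (CochainComplex.IsKProjective.homotopyZero (biprod.inr ≫ f) hM).compLeft
      (biprod.snd : K ⊞ L ⟶ L)
    refine ⟨(Homotopy.ofEq ?_).trans ((h₁.add h₂).trans (Homotopy.ofEq ?_))⟩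
    · rw [← Category.assoc, ← Category.assoc, ← Preadditive.add_comp, biprod.total,
        Category.id_comp]
    · simp

variable {A : Type u} [Ring A] [HasDerivedCategory.{w} (ModuleCat.{u} A)]

/-- The cocomplete pre-aisle generated by an object which is represented by a K-projective complex
is the aisle of a t-structure, with coaisle the objects that admit no nonzero morphism from a
positive shift of this object. -/
theorem exists_tStructure_of_isKProjective (E : DerivedCategory (ModuleCat.{u} A))
    (G : CochainComplex (ModuleCat.{u} A) ℤ) [G.IsKProjective]
    (e : DerivedCategory.Q.obj G ≅ E) :
    ∃ t : TStructure (DerivedCategory (ModuleCat.{u} A)), IsGeneratedBy.{u} t E ∧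
      t.ge 0 = fun X ↦ ∀ (k : ℤ), 0 < k → ∀ a : E⟦k⟧ ⟶ X, a = 0 := by
  have hP := isCocompletePreaisle_generatedPreaisle.{u} E
  refine exists_tStructure_of_exists_triangle E fun X ↦ ?_
  obtain ⟨U, V, f, g, h, hT, hU, hV⟩ := hP.exists_triangle G
    (hP.of_iso e.symm (generatedPreaisle_self E)) X
  refine ⟨U, V, f, g, h, hT, hU, fun k hk a ↦ ?_⟩
  lift k to ℕ using hk
  exact (cancel_epi ((shiftFunctor _ (k : ℤ)).mapIso e).hom).1 ((hV k _).trans comp_zero.symm)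

end

/-! ### Morphisms from shifts of modules -/

section

theorem isStrictlyGE_cochainComplex {C : Type*} [Category* C] [Abelian C] {M : C}
    (R : ProjectiveResolution M) {n : ℕ} (hR : ∀ i : ℕ, n < i → IsZero (R.complex.X i)) :
    R.cochainComplex.IsStrictlyGE (-n) := by
  rw [CochainComplex.isStrictlyGE_iff]
  intro i hi
  exact (hR (-i).toNat (by lia)).of_iso (R.cochainComplexXIso i (-i).toNat (by lia))

variable {A : Type u} [Ring A] [HasDerivedCategory.{w} (ModuleCat.{u} A)]

/-- A projective resolution represents the module in the derived category. -/
noncomputable def projectiveResolutionIso {M : ModuleCat.{u} A} (R : ProjectiveResolution M) :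
    DerivedCategory.Q.obj R.cochainComplex ≅ inDegreeZero M :=
  asIso (DerivedCategory.Q.map R.π') ≪≫
    ((DerivedCategory.singleFunctorIsoCompQ (ModuleCat.{u} A) 0).app M).symm

/-- A K-projective complex which vanishes below degree `q` admits no nonzero morphism to an object
whose cohomology vanishes from degree `q` on. -/
theorem eq_zero_of_isStrictlyGE_of_isLE (K : CochainComplex (ModuleCat.{u} A) ℤ) [K.IsKProjective]
    {p q : ℤ} (hpq : p < q) [K.IsStrictlyGE q] {Y : DerivedCategory (ModuleCat.{u} A)}
    (hY : Y.IsLE p) (f : DerivedCategory.Q.obj K ⟶ Y) : f = 0 := by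
  obtain ⟨L, hL, ⟨e⟩⟩ := Y.exists_iso_Q_obj_of_isLE p
  obtain ⟨φ, hφ⟩ := Q_map_surjective_of_isKProjective K L (f ≫ e.hom)
  have : φ = 0 := by
    ext1 i
    by_cases hi : i < q
    · exact (K.isZero_of_isStrictlyGE q i hi).eq_of_src _ _
    · exact (L.isZero_of_isStrictlyLE p i (by lia)).eq_of_tgt _ _
  rw [this, Functor.map_zero] at hφ
  exact (cancel_mono e.hom).1 (hφ.symm.trans zero_comp.symm)

/-- A shift `M⟦m⟧` of a module of projective dimension at most `n` admits no nonzero morphism to an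
object with cohomology in degrees at most `p`, when `p + m + n < 0`. -/
theorem eq_zero_of_projectiveDimension {M : ModuleCat.{u} A} (R : ProjectiveResolution M) {n : ℕ}
    (hR : ∀ i : ℕ, n < i → IsZero (R.complex.X i)) {p m : ℤ} (h : p + m + n < 0)
    {Y : DerivedCategory (ModuleCat.{u} A)} (hY : Y.IsLE p) (f : (inDegreeZero M)⟦m⟧ ⟶ Y) :
    f = 0 := by
  have := isStrictlyGE_cochainComplex R hR
  have : (R.cochainComplex⟦m⟧).IsStrictlyGE (-n - m) :=
    R.cochainComplex.isStrictlyGE_shift (-n) m (-n - m) (by lia)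
  let e : DerivedCategory.Q.obj (R.cochainComplex⟦m⟧) ≅ (inDegreeZero M)⟦m⟧ :=
    (DerivedCategory.Q.commShiftIso m).app R.cochainComplex ≪≫
      (shiftFunctor _ m).mapIso (projectiveResolutionIso R)
  exact (cancel_epi e.hom).1 ((eq_zero_of_isStrictlyGE_of_isLE (R.cochainComplex⟦m⟧)
    (q := -n - m) (by lia) hY _).trans comp_zero.symm)

theorem isLE_inDegreeZero_shift (M : ModuleCat.{u} A) (m : ℤ) :
    ((inDegreeZero M)⟦m⟧).IsLE (-m) :=
  DerivedCategory.TStructure.t.isLE_shift _ 0 m (-m) (by lia)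

theorem isZero_homology_shift_iff (Y : DerivedCategory (ModuleCat.{u} A)) (m i j : ℤ)
    (h : m + i = j) : IsZero ((DerivedCategory.homologyFunctor _ i).obj (Y⟦m⟧)) ↔
      IsZero ((DerivedCategory.homologyFunctor (ModuleCat.{u} A) j).obj Y) :=
  (((DerivedCategory.homologyFunctor (ModuleCat.{u} A) 0).shiftIso m i j h).app Y).isZero_iff

theorem forall_eq_zero_shift_iff {C : Type*} [Category* C] [Preadditive C] [HasShift C ℤ]
    [∀ n : ℤ, (shiftFunctor C n).Additive] {X Y : C} {m a k : ℤ} (h : m + a = k) :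
    (∀ f : X⟦k⟧ ⟶ Y⟦a⟧, f = 0) ↔ ∀ f : X⟦m⟧ ⟶ Y, f = 0 := by
  refine ⟨fun H f ↦ (shiftFunctor C a).map_injective ?_, fun H ↦ eq_zero_of_shift h H⟩
  rw [Functor.map_zero]
  exact (cancel_epi ((shiftFunctorAdd' C m a k h).hom.app X)).1 ((H _).trans comp_zero.symm)

theorem forall_eq_zero_shift_zero_iff {C : Type*} [Category* C] [Preadditive C] [HasShift C ℤ]
    {X Y : C} : (∀ f : X⟦(0 : ℤ)⟧ ⟶ Y, f = 0) ↔ ∀ f : X ⟶ Y, f = 0 :=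
  ⟨fun H _ ↦ (cancel_epi ((shiftFunctorZero C ℤ).app X).hom).1 ((H _).trans comp_zero.symm),
    fun H _ ↦ (cancel_epi ((shiftFunctorZero C ℤ).app X).inv).1 ((H _).trans comp_zero.symm)⟩

theorem homologyMap_eq_zero_of_Q_map_eq_zero {K L : CochainComplex (ModuleCat.{u} A) ℤ} (φ : K ⟶ L)
    (hφ : DerivedCategory.Q.map φ = 0) (i : ℤ) : HomologicalComplex.homologyMap φ i = 0 := by
  have := (DerivedCategory.homologyFunctorFactors (ModuleCat.{u} A) i).hom.naturality φ
  dsimp at this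
  rw [hφ, Functor.map_zero, zero_comp] at this
  exact (cancel_epi ((DerivedCategory.homologyFunctorFactors (ModuleCat.{u} A) i).hom.app
    _)).1 (this.symm.trans comp_zero.symm)

theorem isZero_homology_of_forall_eq_zero (Y : DerivedCategory (ModuleCat.{u} A))
    (H : ∀ f : inDegreeZero (ModuleCat.of A A) ⟶ Y, f = 0) :
    IsZero ((DerivedCategory.homologyFunctor (ModuleCat.{u} A) 0).obj Y) := by
  let L := DerivedCategory.Q.objPreimage Y
  let e : DerivedCategory.Q.obj L ≅ Y := DerivedCategory.Q.objObjPreimageIso Y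
  suffices L.homologyπ 0 = 0 from
    ((IsZero.of_epi_eq_zero _ this).of_iso
      ((DerivedCategory.homologyFunctorFactors (ModuleCat.{u} A) 0).app L)).of_iso
        ((DerivedCategory.homologyFunctor (ModuleCat.{u} A) 0).mapIso e.symm)
  -- every cycle is the image of `1` under a morphism of complexes from `A`
  have key (a : ModuleCat.of A A ⟶ L.cycles 0) : a ≫ L.homologyπ 0 = 0 := by
    let φ : (HomologicalComplex.single _ _ 0).obj (ModuleCat.of A A) ⟶ L :=
      HomologicalComplex.mkHomFromSingle (a ≫ L.iCycles 0) (by simp)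
    have hφ : DerivedCategory.Q.map φ = 0 := by
      have := H ((DerivedCategory.singleFunctorIsoCompQ (ModuleCat.{u} A) 0).hom.app _ ≫
        DerivedCategory.Q.map φ ≫ e.hom)
      rwa [← Category.assoc, ← cancel_mono e.inv, Category.assoc, e.hom_inv_id, Category.comp_id,
        zero_comp, ← cancel_epi ((DerivedCategory.singleFunctorIsoCompQ _ 0).inv.app _),
        Iso.inv_hom_id_app_assoc, comp_zero] at this
    have hφ' := homologyMap_eq_zero_of_Q_map_eq_zero φ hφ 0
    have ha : (HomologicalComplex.singleObjCyclesSelfIso _ 0 _).inv ≫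
        HomologicalComplex.cyclesMap φ 0 = a := by
      rw [← cancel_mono (L.iCycles 0)]
      simp [φ]
    rw [← ha, Category.assoc, ← HomologicalComplex.homologyπ_naturality, hφ', comp_zero, comp_zero]
  ext z
  have h : L.homologyπ 0 ((1 : A) • z) = 0 :=
    congr_arg (fun f ↦ f (1 : A)) (key (ModuleCat.ofHom (LinearMap.toSpanSingleton A _ z)))
  rwa [one_smul] at h

/-- Cohomology is corepresented by the shifts of `A`, as far as vanishing is concerned. -/
theorem forall_eq_zero_iff_isZero_homology (Y : DerivedCategory (ModuleCat.{u} A)) {m j : ℤ}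
    (h : m + j = 0) : (∀ f : (inDegreeZero (ModuleCat.of A A))⟦m⟧ ⟶ Y, f = 0) ↔
      IsZero ((DerivedCategory.homologyFunctor (ModuleCat.{u} A) j).obj Y) := by
  rw [← forall_eq_zero_shift_iff (a := j) (k := 0) h, forall_eq_zero_shift_zero_iff,
    ← isZero_homology_shift_iff Y j 0 j (add_zero j)]
  refine ⟨isZero_homology_of_forall_eq_zero _, fun H f ↦ ?_⟩
  -- `f` factors through the truncation `U` in degrees `≤ 0`, whose cohomology also vanishes in
  -- degree `0`
  obtain ⟨U, V, hU, hV, i, p, δ, hT⟩ :=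
    DerivedCategory.TStructure.t.exists_triangle (Y⟦j⟧) 0 1 rfl
  have hf : f ≫ p = 0 := DerivedCategory.TStructure.t.zero_of_isLE_of_isGE _ 0 1 one_pos
    inferInstance ⟨hV⟩
  obtain ⟨g, rfl⟩ := exists_lift₂ hT f hf
  have hU' : U.IsLE (-1) := by
    rw [DerivedCategory.isLE_iff]
    intro k hk
    by_cases hk0 : k = 0
    · subst hk0
      have : V.IsGE 1 := ⟨hV⟩
      exact (DerivedCategory.HomologySequence.exact₁ _ hT (-1) 0 rfl).isZero_of_both_zeros
        ((V.isZero_of_isGE 1 (-1) (by lia)).eq_of_src _ _) (H.eq_of_tgt _ _)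
    · have : U.IsLE 0 := ⟨hU⟩
      exact U.isZero_of_isLE 0 k (by lia)
  have hg : g = 0 := forall_eq_zero_shift_zero_iff.1 (fun f ↦
    eq_zero_of_projectiveDimension (.self (ModuleCat.of A A)) (n := 0)
      (fun i hi ↦ HomologicalComplex.isZero_single_obj_X _ _ _ _ hi.ne') (by lia) hU' f) g
  rw [hg, zero_comp]

end

/-! ### Tilting modules and their coproducts -/

section

/-- The module of finitely supported functions is the coproduct of copies of `M`. -/
noncomputable def isColimitFinsuppCofan {A : Type u} [Ring A] (M : ModuleCat.{u} A) (I : Type u) :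
    IsColimit (Cofan.mk (f := fun _ : I ↦ M) (ModuleCat.of A (I →₀ M))
      (fun i ↦ ModuleCat.ofHom (Finsupp.lsingle i))) :=
  Cofan.IsColimit.mk _ (fun s ↦ ModuleCat.ofHom (Finsupp.lsum ℕ (fun i ↦ (s.inj i).hom)))
    (fun s i ↦ by ext x; simp)
    (fun s m hm ↦ by
      ext : 1
      refine Finsupp.lhom_ext' fun i ↦ ?_
      ext x
      simpa using congr_arg (fun f ↦ f x) (hm i))

variable {A : Type u} [Ring A] [HasDerivedCategory.{w} (ModuleCat.{u} A)]

/-- The module of finitely supported functions is also the coproduct of copies of `M` in the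
derived category, in any degree. -/
noncomputable def isColimitFinsuppCofanShift (M : ModuleCat.{u} A) (I : Type u) (k : ℤ) :
    IsColimit (Cofan.mk (f := fun _ : I ↦ (inDegreeZero M)⟦k⟧)
      ((inDegreeZero (ModuleCat.of A (I →₀ M)))⟦k⟧)
      (fun i ↦ ((DerivedCategory.singleFunctor (ModuleCat.{u} A) 0).map
        (ModuleCat.ofHom (Finsupp.lsingle i)))⟦k⟧')) :=
  have := preservesColimitsOfShape_Q (C := ModuleCat.{u} A) I
  have : PreservesColimitsOfShape (Discrete I) (CochainComplex.singleFunctor (ModuleCat.{u} A) 0) :=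
    inferInstanceAs (PreservesColimitsOfShape _ (HomologicalComplex.single _ _ _))
  have := preservesColimitsOfShape_of_natIso (J := Discrete I)
    (DerivedCategory.singleFunctorIsoCompQ (ModuleCat.{u} A) 0).symm
  isColimitCofanMkObjOfIsColimit (DerivedCategory.singleFunctor (ModuleCat.{u} A) 0 ⋙
    shiftFunctor _ k) _ _ (isColimitFinsuppCofan M I)

/-- Morphisms from a shift of a module to a fixed object are exhausted by a family indexed by a
type in the universe of the ring, namely by morphisms of complexes from a projective resolution. -/
theorem exists_small_family (M : ModuleCat.{u} A) (m : ℤ) (X : DerivedCategory (ModuleCat.{u} A)) :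
    ∃ (I : Type u) (f : I → ((inDegreeZero M)⟦m⟧ ⟶ X)), Function.Surjective f := by
  let R := projectiveResolution M
  let e : DerivedCategory.Q.obj (R.cochainComplex⟦m⟧) ≅ (inDegreeZero M)⟦m⟧ :=
    (DerivedCategory.Q.commShiftIso m).app R.cochainComplex ≪≫
      (shiftFunctor _ m).mapIso (projectiveResolutionIso R)
  let e' := DerivedCategory.Q.objObjPreimageIso X
  refine ⟨R.cochainComplex⟦m⟧ ⟶ DerivedCategory.Q.objPreimage X,
    fun φ ↦ e.inv ≫ DerivedCategory.Q.map φ ≫ e'.hom, fun f ↦ ?_⟩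
  obtain ⟨φ, hφ⟩ := Q_map_surjective_of_isKProjective _ _ (e.hom ≫ f ≫ e'.inv)
  exact ⟨φ, by simp [hφ]⟩

variable {n : ℕ} {T : ModuleCat.{u} A}

/-- A tilting module has no nonzero morphisms to positive shifts of coproducts of its copies. -/
theorem IsTilting.eq_zero (hT : IsTilting n T) (I : Type u) {m k : ℤ} (hmk : m < k)
    (f : (inDegreeZero T)⟦m⟧ ⟶ (inDegreeZero (ModuleCat.of A (I →₀ T)))⟦k⟧) : f = 0 := by
  by_cases h : k - m ≤ n
  · obtain ⟨j, hj⟩ := Int.eq_ofNat_of_zero_le (a := k - m) (by lia)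
    have := hT.rigid j (by lia) (by lia) I
    have h₁ : ∀ f : inDegreeZero T ⟶ (inDegreeZero (ModuleCat.of A (I →₀ T)))⟦(j : ℤ)⟧, f = 0 :=
      fun f ↦ (Abelian.Ext.homEquiv (X := T) (Y := ModuleCat.of A (I →₀ T))
        (n := j)).symm.injective (Subsingleton.elim _ _)
    have h₂ := (forall_eq_zero_shift_iff (m := -j) (by lia)).1 (forall_eq_zero_shift_zero_iff.2 h₁)
    exact (forall_eq_zero_shift_iff (by lia)).2 h₂ f
  · obtain ⟨R, hR⟩ := hT.projective_dimension
    exact eq_zero_of_projectiveDimension R hR (by lia) (isLE_inDegreeZero_shift _ k) f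

/-- If `X` receives no nonzero morphism from `T⟦m⟧` for `m < k`, the cone of a map from a
coproduct of copies of `T⟦k⟧` to `X` which exhausts the morphisms `T⟦k⟧ ⟶ X` has the same property
for `m ≤ k`. It changes cohomology only in degrees `≤ -k`, and objects without nonzero morphisms
from `T⟦k⟧` do not see the difference. -/
theorem IsTilting.exists_next (hT : IsTilting n T) (k : ℕ) (X : DerivedCategory (ModuleCat.{u} A))
    (hX : ∀ m : ℤ, m < k → ∀ f : (inDegreeZero T)⟦m⟧ ⟶ X, f = 0) :
    ∃ (X' : DerivedCategory (ModuleCat.{u} A)) (a : X ⟶ X'),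
      (∀ m : ℤ, m < (k + 1 : ℕ) → ∀ f : (inDegreeZero T)⟦m⟧ ⟶ X', f = 0) ∧
      (∀ i : ℤ, -k < i → IsIso ((DerivedCategory.homologyFunctor _ i).map a)) ∧
      ∀ Y : DerivedCategory (ModuleCat.{u} A),
        (∀ m : ℤ, 0 ≤ m → ∀ f : (inDegreeZero T)⟦m⟧ ⟶ Y, f = 0) →
          ∀ f : X ⟶ Y, ∃ f' : X' ⟶ Y, a ≫ f' = f := by
  obtain ⟨I, b, hb⟩ := exists_small_family T k X
  have hc := isColimitFinsuppCofanShift T I k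
  let g := Cofan.IsColimit.desc hc b
  have hg (i : I) := Cofan.IsColimit.fac hc b i
  obtain ⟨X', a, δ, hD⟩ := distinguished_cocone_triangle g
  refine ⟨X', a, fun m hm f ↦ ?_, fun i hi ↦ ?_, fun Y hY f ↦ exists_desc₂ hD f ?_⟩
  · have hf : f ≫ δ = 0 :=
      (cancel_mono ((shiftFunctorAdd' _ (k : ℤ) 1 (k + 1) rfl).inv.app _)).1
        ((hT.eq_zero I (by push_cast at hm; exact hm) _).trans zero_comp.symm)
    obtain ⟨f', rfl⟩ := exists_lift₃ hD f hf
    obtain hm | rfl : m < k ∨ m = k := by lia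
    · rw [hX m hm f', zero_comp]
    · obtain ⟨i, rfl⟩ := hb f'
      rw [← hg i, Category.assoc, comp_eq_zero₁₂ hD, comp_zero]
  · have := isLE_inDegreeZero_shift (ModuleCat.of A (I →₀ T)) k
    have hM (j : ℤ) (hj : -k < j) := DerivedCategory.isZero_of_isLE
      ((inDegreeZero (ModuleCat.of A (I →₀ T)))⟦(k : ℤ)⟧) (-k) j hj
    have h₁ : Mono ((DerivedCategory.homologyFunctor _ i).map a) :=
      (DerivedCategory.HomologySequence.mono_homologyMap_mor₂_iff _ hD i).2
        ((hM i hi).eq_of_src _ _)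
    have h₂ : Epi ((DerivedCategory.homologyFunctor _ i).map a) :=
      (DerivedCategory.HomologySequence.epi_homologyMap_mor₂_iff _ hD i (i + 1) rfl).2
        ((hM (i + 1) (by lia)).eq_of_tgt _ _)
    exact isIso_of_mono_of_epi _
  · exact Cofan.IsColimit.hom_ext hc _ _ fun i ↦
      (hY k (by lia) _).trans (hY k (by lia) _).symm

end

/-! ### The coaisles attached to a tilting module -/

section

theorem isEventuallyConstantFrom_of_isIso_succ {C : Type*} [Category* C] (F : ℕ ⥤ C) (k : ℕ)
    (h : ∀ j, k ≤ j → IsIso (F.map (homOfLE j.le_succ))) : F.IsEventuallyConstantFrom k := by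
  have key (j : ℕ) (hj : k ≤ j) : IsIso (F.map (homOfLE hj)) := by
    induction j, hj using Nat.le_induction with
    | base => exact inferInstanceAs (IsIso (F.map (𝟙 k)))
    | succ j hj ih =>
      have := h j hj
      rw [show homOfLE (hj.trans j.le_succ) = homOfLE hj ≫ homOfLE j.le_succ from rfl, F.map_comp]
      infer_instance
  exact fun j f ↦ key j (leOfHom f)

variable {A : Type u} [Ring A] [HasDerivedCategory.{w} (ModuleCat.{u} A)]
  {n : ℕ} {T : ModuleCat.{u} A}

/-- If an object admits no nonzero morphism from nonnegative shifts of an `n`-tilting module, then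
it admits no nonzero morphism from `A⟦n⟧`: such a morphism extends to the colimit of the tower
which starts with `A⟦n⟧` and kills all morphisms from shifts of `T`, and this colimit is zero
because `T` is a generator. -/
theorem IsTilting.eq_zero_of_shift_nonneg (hT : IsTilting n T)
    {Y : DerivedCategory (ModuleCat.{u} A)}
    (hY : ∀ m : ℤ, 0 ≤ m → ∀ f : (inDegreeZero T)⟦m⟧ ⟶ Y, f = 0)
    (f : (inDegreeZero (ModuleCat.of A A))⟦(n : ℤ)⟧ ⟶ Y) : f = 0 := by
  let H := DerivedCategory.homologyFunctor (ModuleCat.{u} A)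
  obtain ⟨R, hR⟩ := hT.projective_dimension
  choose X' a hX' ha hext using hT.exists_next
  let s (k : ℕ) : { X : DerivedCategory (ModuleCat.{u} A) //
      ∀ m : ℤ, m < k → ∀ f : (inDegreeZero T)⟦m⟧ ⟶ X, f = 0 } :=
    Nat.rec ⟨(inDegreeZero (ModuleCat.of A A))⟦(n : ℤ)⟧, fun m hm f ↦
      eq_zero_of_projectiveDimension R hR (by push_cast at hm; lia)
        (isLE_inDegreeZero_shift _ n) f⟩ (fun k X ↦ ⟨X' k X.1 X.2, hX' k X.1 X.2⟩) k
  let F : ℕ ⥤ DerivedCategory (ModuleCat.{u} A) :=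
    Functor.ofSequence (X := fun k ↦ (s k).1) (fun k ↦ a k (s k).1 (s k).2)
  have hF (k : ℕ) : F.map (homOfLE k.le_succ) = a k (s k).1 (s k).2 :=
    Functor.ofSequence_map_homOfLE_succ _ k
  obtain ⟨c, hdesc, hcolim, -⟩ := exists_homotopyColimit F
  have hι (k : ℕ) (i : ℤ) (hi : -k < i) : IsIso ((H i).map (c.ι.app k)) := by
    have hconst : (F ⋙ H i).IsEventuallyConstantFrom k :=
      isEventuallyConstantFrom_of_isIso_succ _ k fun j hj ↦ by
        have : IsIso ((H i).map (F.map (homOfLE j.le_succ))) := by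
          rw [hF]
          exact ha j _ _ i (by lia)
        exact this
    exact hconst.isIso_ι_of_isColimit (hcolim i).some
  -- a morphism from a shift of `T` to the colimit factors through a late stage of the tower
  have hc : IsZero c.pt := by
    refine hT.generator c.pt fun i ↦ forall_eq_zero_shift_zero_iff.1
      ((forall_eq_zero_shift_iff (m := -i) (by lia)).2 fun f ↦ ?_)
    -- the cone of the map from stage `k` lives in degrees `≤ -k`, too low for `T⟦-i⟧`
    let k : ℕ := (-i).toNat + n + 1
    obtain ⟨Z, p, δ, hD⟩ := distinguished_cocone_triangle (c.ι.app k)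
    have hZ : Z.IsLE (-k) := by
      rw [DerivedCategory.isLE_iff]
      intro j hj
      have h₁ : IsIso ((H j).map (c.ι.app k)) := hι k j hj
      have h₂ : IsIso ((H (j + 1)).map (c.ι.app k)) := hι k (j + 1) (by lia)
      exact (DerivedCategory.HomologySequence.exact₃ _ hD j (j + 1) rfl).isZero_of_both_zeros
        ((DerivedCategory.HomologySequence.epi_homologyMap_mor₁_iff _ hD j).1
          (inferInstanceAs (Epi ((H j).map (c.ι.app k)))))
        ((DerivedCategory.HomologySequence.mono_homologyMap_mor₁_iff _ hD j (j + 1) rfl).1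
          (inferInstanceAs (Mono ((H (j + 1)).map (c.ι.app k)))))
    obtain ⟨g, rfl⟩ := exists_lift₂ hD f (eq_zero_of_projectiveDimension R hR (by lia) hZ _)
    exact ((s k).2 (-i) (by lia) g =≫ c.ι.app k).trans zero_comp
  -- the given morphism extends successively along the tower
  choose ext hext using hext
  let φ (k : ℕ) : (s k).1 ⟶ Y := Nat.rec f (fun k g ↦ ext k (s k).1 (s k).2 Y hY g) k
  let c' : Cocone F :=
    { pt := Y
      ι := NatTrans.ofSequence φ (fun k ↦
        ((hF k =≫ _).trans (hext k (s k).1 (s k).2 Y hY (φ k))).trans (Category.comp_id _).symm) }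
  obtain ⟨g, hg⟩ := hdesc c'
  have h₀ : c.ι.app 0 ≫ g = f := hg 0
  exact h₀.symm.trans ((_ ≫= hc.eq_of_src g 0).trans comp_zero)

theorem tiltingGE_iff (X : DerivedCategory (ModuleCat.{u} A)) :
    tiltingGE T X ↔ ∀ m : ℤ, 0 < m → ∀ f : (inDegreeZero T)⟦m⟧ ⟶ X, f = 0 := by
  have h (i m : ℤ) (hm : m = -i) : (∀ f : inDegreeZero T ⟶ X⟦i⟧, f = 0) ↔
      ∀ f : (inDegreeZero T)⟦m⟧ ⟶ X, f = 0 := by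
    rw [← forall_eq_zero_shift_iff (a := i) (k := 0) (by lia), forall_eq_zero_shift_zero_iff]
  exact ⟨fun H m hm ↦ (h (-m) m (by lia)).1 (H (-m) (by lia)),
    fun H i hi ↦ (h i (-i) rfl).2 (H (-i) (by lia))⟩

theorem naturalGE_iff (X : DerivedCategory (ModuleCat.{u} A)) (i : ℤ) :
    naturalGE A i X ↔
      ∀ m : ℤ, -i < m → ∀ f : (inDegreeZero (ModuleCat.of A A))⟦m⟧ ⟶ X, f = 0 :=
  ⟨fun H m hm ↦ (forall_eq_zero_iff_isZero_homology X (j := -m) (by lia)).2 (H (-m) (by lia)),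
    fun H j hj ↦ (forall_eq_zero_iff_isZero_homology X (m := -j) (by lia)).1 (H (-j) (by lia))⟩

/-- Apply `IsTilting.eq_zero_of_shift_nonneg` to shifts of the given object. -/
theorem IsTilting.tiltingGE_le_naturalGE (hT : IsTilting n T) : tiltingGE T ≤ naturalGE A (-n) := by
  intro X hX
  rw [tiltingGE_iff] at hX
  rw [naturalGE_iff]
  intro m hm
  have h := hT.eq_zero_of_shift_nonneg (Y := X⟦n - m⟧) fun j hj ↦
    (forall_eq_zero_shift_iff (m := j - (n - m)) (by lia)).2 (hX _ (by lia))
  exact (forall_eq_zero_shift_iff (by lia)).1 h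

theorem naturalGE_zero_le_tiltingGE : naturalGE A 0 ≤ tiltingGE T := by
  intro X hX
  have hX' : X.IsGE 0 := (DerivedCategory.isGE_iff X 0).2 hX
  rw [tiltingGE_iff]
  intro m hm f
  exact DerivedCategory.TStructure.t.zero_of_isLE_of_isGE f (-m) 0 (by lia)
    (isLE_inDegreeZero_shift T m) hX'

theorem naturalGE_antitone {i j : ℤ} (h : i ≤ j) : naturalGE A j ≤ naturalGE A i :=
  fun _ hX k hk ↦ hX k (by lia)

theorem forall_eq_zero_biprod_shift_iff {C : Type*} [Category* C] [Preadditive C] [HasShift C ℤ]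
    [∀ n : ℤ, (shiftFunctor C n).Additive] {X Y Z : C} [HasBinaryBiproduct X Y] (k : ℤ) :
    (∀ f : (X ⊞ Y)⟦k⟧ ⟶ Z, f = 0) ↔
      (∀ f : X⟦k⟧ ⟶ Z, f = 0) ∧ ∀ f : Y⟦k⟧ ⟶ Z, f = 0 := by
  refine ⟨fun H ↦ ⟨fun f ↦ ?_, fun f ↦ ?_⟩, fun H f ↦ ?_⟩
  · have := (biprod.inl : X ⟶ X ⊞ Y)⟦k⟧' ≫= H ((biprod.fst : X ⊞ Y ⟶ X)⟦k⟧' ≫ f)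
    rwa [← Functor.map_comp_assoc, biprod.inl_fst, CategoryTheory.Functor.map_id, Category.id_comp,
      comp_zero] at this
  · have := (biprod.inr : Y ⟶ X ⊞ Y)⟦k⟧' ≫= H ((biprod.snd : X ⊞ Y ⟶ Y)⟦k⟧' ≫ f)
    rwa [← Functor.map_comp_assoc, biprod.inr_snd, CategoryTheory.Functor.map_id, Category.id_comp,
      comp_zero] at this
  · have h : 𝟙 ((X ⊞ Y)⟦k⟧) = (biprod.fst : X ⊞ Y ⟶ X)⟦k⟧' ≫ (biprod.inl : X ⟶ X ⊞ Y)⟦k⟧' +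
        (biprod.snd : X ⊞ Y ⟶ Y)⟦k⟧' ≫ (biprod.inr : Y ⟶ X ⊞ Y)⟦k⟧' := by
      rw [← Functor.map_comp, ← Functor.map_comp, ← Functor.map_add, biprod.total,
        CategoryTheory.Functor.map_id]
    rw [← Category.id_comp f, h, Preadditive.add_comp, Category.assoc, Category.assoc,
      H.1 (_ ≫ f), H.2 (_ ≫ f), comp_zero, comp_zero, add_zero]

/-- `𝒟ᵢ^≥` consists of the objects which admit no nonzero morphism from a positive shift of
`T ⊞ A⟦i⟧`, as `A⟦i⟧⟦m⟧` detects the cohomology in degree `-i - m`. -/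
theorem intermediateGE_iff (X : DerivedCategory (ModuleCat.{u} A)) (i : ℕ) :
    intermediateGE T i X ↔ ∀ m : ℤ, 0 < m → ∀ f : (inDegreeZero T ⊞
      (inDegreeZero (ModuleCat.of A A))⟦(i : ℤ)⟧)⟦m⟧ ⟶ X, f = 0 := by
  have h (m k : ℤ) (hk : i + m = k) :
      (∀ f : (inDegreeZero (ModuleCat.of A A))⟦(i : ℤ)⟧⟦m⟧ ⟶ X, f = 0) ↔
        ∀ f : (inDegreeZero (ModuleCat.of A A))⟦k⟧ ⟶ X, f = 0 :=
    ⟨fun H f ↦ (cancel_epi ((shiftFunctorAdd' _ (i : ℤ) m k hk).inv.app _)).1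
      ((H _).trans comp_zero.symm),
      fun H f ↦ (cancel_epi ((shiftFunctorAdd' _ (i : ℤ) m k hk).hom.app _)).1
      ((H _).trans comp_zero.symm)⟩
  simp only [forall_eq_zero_biprod_shift_iff]
  change naturalGE A (-(i : ℤ)) X ∧ tiltingGE T X ↔ _
  rw [naturalGE_iff, tiltingGE_iff]
  exact ⟨fun H m hm ↦ ⟨H.2 m hm, (h m _ rfl).2 (H.1 _ (by lia))⟩,
    fun H ↦ ⟨fun m hm ↦ (h (m - i) m (by lia)).1 (H (m - i) (by lia)).2, fun m hm ↦ (H m hm).1⟩⟩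

theorem exists_tStructure_intermediateGE (T : ModuleCat.{u} A) (i : ℕ) :
    ∃ t : TStructure (DerivedCategory (ModuleCat.{u} A)), t.ge 0 = intermediateGE T i ∧
      IsGeneratedBy.{u} t (inDegreeZero T ⊞ (inDegreeZero (ModuleCat.of A A))⟦(i : ℤ)⟧) := by
  let R := projectiveResolution T
  let R' := projectiveResolution (ModuleCat.of A A)
  have : (R.cochainComplex ⊞ R'.cochainComplex⟦(i : ℤ)⟧).IsKProjective := isKProjective_biprod _ _
  have := preservesBinaryBiproducts_of_preservesBiproducts
    (DerivedCategory.Q (C := ModuleCat.{u} A))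
  let e : DerivedCategory.Q.obj (R.cochainComplex ⊞ R'.cochainComplex⟦(i : ℤ)⟧) ≅
      inDegreeZero T ⊞ (inDegreeZero (ModuleCat.of A A))⟦(i : ℤ)⟧ :=
    DerivedCategory.Q.mapBiprod _ _ ≪≫ biprod.mapIso (projectiveResolutionIso R)
      ((DerivedCategory.Q.commShiftIso (i : ℤ)).app _ ≪≫
        (shiftFunctor _ (i : ℤ)).mapIso (projectiveResolutionIso R'))
  obtain ⟨t, ht, hge⟩ := exists_tStructure_of_isKProjective _ _ e
  exact ⟨t, hge.trans (funext fun X ↦ propext (intermediateGE_iff X i).symm), ht⟩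

theorem intermediateGE_succ_le_suspension (T : ModuleCat.{u} A) (i : ℕ) :
    intermediateGE T (i + 1) ≤ suspension (intermediateGE T i) := by
  refine fun X hX ↦ ⟨X⟦(-1 : ℤ)⟧, ⟨fun j hj ↦ ?_, ?_⟩,
    ⟨((shiftEquiv (DerivedCategory (ModuleCat.{u} A)) (1 : ℤ)).counitIso.app X).symm⟩⟩
  · rw [isZero_homology_shift_iff X (-1) j (j - 1) (by lia)]
    exact hX.1 _ (by push_cast; lia)
  · rw [tiltingGE_iff]
    exact fun m hm ↦ (forall_eq_zero_shift_iff (m := m + 1) (by lia)).2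
      ((tiltingGE_iff X).1 hX.2 _ (by lia))

end

end TiltingTStructure

theorem mainTheorem5 (A : Type u) [Ring A] [HasDerivedCategory.{w} (ModuleCat.{u} A)]
    (n : ℕ) (T : ModuleCat.{u} A) (hT : TiltingTStructure.IsTilting n T) :
    (∀ i : ℕ, i ≤ n →
      ∃ t : TStructure (DerivedCategory (ModuleCat.{u} A)),
        t.ge 0 = TiltingTStructure.intermediateGE T i ∧
        TiltingTStructure.IsGeneratedBy.{u} t
          (TiltingTStructure.inDegreeZero T ⊞
            (TiltingTStructure.inDegreeZero (ModuleCat.of A A))⟦(i : ℤ)⟧)) ∧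
    TiltingTStructure.naturalGE A 0 = TiltingTStructure.intermediateGE T 0 ∧
    TiltingTStructure.intermediateGE T n = TiltingTStructure.tiltingGE T ∧
    (∀ i : ℕ, i < n →
      TiltingTStructure.intermediateGE T i ≤ TiltingTStructure.intermediateGE T (i + 1) ∧
      TiltingTStructure.intermediateGE T (i + 1) ≤
        TiltingTStructure.suspension (TiltingTStructure.intermediateGE T i)) := by
  open TiltingTStructure in
  exact ⟨fun i _ ↦ exists_tStructure_intermediateGE T i,
    le_antisymm (le_inf (naturalGE_antitone (by simp)) naturalGE_zero_le_tiltingGE)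
      (inf_le_left.trans (naturalGE_antitone (by simp))),
    le_antisymm inf_le_right (le_inf hT.tiltingGE_le_naturalGE le_rfl),
    fun i _ ↦ ⟨inf_le_inf_right _ (naturalGE_antitone (by push_cast; lia)),
      intermediateGE_succ_le_suspension T i⟩⟩
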